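/- **Setting.** Let $n,T,\ell\ge 1$, $m\ge 0$ be integers, $N=2^n$, $\kappa\in[0,1]$. *Bosons (register $\mathsf S$).* Consider $\ell$ bosons in $N$ modes indexed by $\{0,1\}^n$, with position Fock basis $|u\rangle$, $u\in\mathbb Z_{\ge0}^{\{0,1\}^n}$, $\sum_x u_x=\ell$ (equivalently, $|\mathrm{tt}_S\rangle$ for $S$ the multiset of size $\ell$ with multiplicities $u$), creation and annihilation operators $\hat a_x^\dagger,\hat a_x$, and momentum operators $\tilde a_y=2^{-n/2}\sum_x(-1)^{x\cdot y}\hat a_x$, $\tilde a_y^\dagger=2^{-n/2}\sum_x(-1)^{x\cdot y}\hat a_x^\dagger$, which give the momentum Fock basis $\prod_x (u_x!)^{-1/2}(\tilde a_x^\dagger)^{u_x}|\mathrm{vac}\rangle$. Put $\tilde G_y=\ell^{-1/2}\sum_x\tilde a_{x\oplus y}^\dagger\tilde a_x$. Let $\mathsf{Con}_r$ be the projector onto the span of the momentum Fock states of $\ell$ bosons with $u_0\ge \ell-r$, and $|\mathrm{init}_S\rangle=(\ell!)^{-1/2}(\tilde a_0^\dagger)^\ell|\mathrm{vac}\rangle$.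 Let $e_0(z)=1-e^{-\kappa z}$ and $e_1(z)=\sqrt{e^{-\kappa z}(2-e^{-\kappa z})}$, applied to Hermitian operators by functional calculus, and $$E_x^{(y)}=\sum_S e_x\big(\gamma_y^{(S)}\big)|\mathrm{tt}_S\rangle\langle \mathrm{tt}_S|=e_x(\tilde G_y^2),\qquad \gamma_y^{(S)}=\Big(\ell^{-1/2}\sum_{s\in S}(-1)^{y\cdot s}\Big)^2 .$$ *Register $\mathsf U$.* It consists of one qubit $\mathsf U_y$ with orthonormal basis $|\bot\rangle,|\top\rangle$ for every $y\in\{0,1\}^n$, initially $|\bot\rangle^{\otimes N}$. Let $K^0_y$ and $K^1_y$ be the Pauli $Z$ and $X$ operators on $\mathsf U_y$ in this basis. *Algorithm.* Register $\mathsf A$ holds a control bit $b$, a query string $y\in\{0,1\}^n$ and $m$ workspace qubits; $A$ is any unitary on $\mathsf A$. For a family $B=(B_x^{(y)})$ of operators on $\mathsf S$ ($x\in\{0,1\}$, $y\in\{0,1\}^n$) let $$|\psi_B\rangle=\sum_{\mathbf y\in(\{0,1\}^n)^T,\ \mathbf b\in\{0,1\}^T}\Big[\prod_{i=T}^{1}A\,|b_i,y_i\rangle\langle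 b_i,y_i|\ \otimes\ \sum_{\mathbf x}\ \prod_{i:\,b_i=1}K^{x_i}_{y_i}\otimes\prod_{i:\,b_i=1}B^{(y_i)}_{x_i}\Big]\,A|0\rangle_{\mathsf A}\,|\bot\rangle^{\otimes N}_{\mathsf U}\,|\mathrm{init}_S\rangle_{\mathsf S},$$ where $\mathbf x$ ranges over the assignments of a bit $x_i$ to each $i$ with $b_i=1$, and in all products the factor of the first query ($i=1$) stands on the right. The post-query state is $|\psi_{\mathrm{PQ}}\rangle=|\psi_B\rangle$ for $B_x^{(y)}=E_x^{(y)}$; the sandwiched state $|\tilde\psi_{R,r}\rangle$ is $|\psi_B\rangle$ for $$B_x^{(y)}=\mathsf{Con}_r\cdot e_x\big(\mathsf{Con}_R\,\tilde G_y^2\,\mathsf{Con}_R\big)\cdot\mathsf{Con}_r .$$ **Corollary (Sandwiching property).** There is an absolute constant $C>0$ such that for all integers $n,T\ge1$ and every $\iota>0$ there are integers $r,R>0$ with $$r\le C\,n^2T^5L_T^3L_\iota^2,\qquad R\le C\,n^3T^6L_T^4L_\iota^3,\qquad L_T=\max(1,\ln T),\quad L_\iota=\max(1,\ln(1/\iota)),$$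 such that for all $\ell\ge1$, $m\ge0$, $\kappa\in[0,1]$ and every unitary $A$ as above, $$\big\|\,|\psi_{\mathrm{PQ}}\rangle-|\tilde\psi_{R,r}\rangle\,\big\|\le\iota .$$ -/

import Mathlib

open scoped Matrix Kronecker

noncomputable section

namespace BosonOracle

/-- `n`-bit strings; addition is bitwise XOR and `x ⬝ᵥ y` is the inner product mod 2. -/
abbrev Bits (n : ℕ) : Type := Fin n → ZMod 2

/-- The sign `(-1)^(x·y)`. -/
def sgn {n : ℕ} (x y : Bits n) : ℂ := (-1) ^ (x ⬝ᵥ y).val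

/-! ### Bosons in `2^n` modes -/

/-- Finite superpositions of position Fock states `|u⟩`, where `u x` is the number of bosons in
position mode `x` (any number of bosons). -/
abbrev FockSpace (n : ℕ) : Type := (Bits n → ℕ) →₀ ℂ

/-- The position Fock state `|u⟩`. -/
def ket {n : ℕ} (u : Bits n → ℕ) : FockSpace n := Finsupp.single u 1

/-- The vacuum. -/
def vac (n : ℕ) : FockSpace n := ket 0

/-- Position annihilation operator: `a_x |u⟩ = √(u_x) |u - 1_x⟩` (which is `0` if `u_x = 0`). -/
def annPos {n : ℕ} (x : Bits n) : Module.End ℂ (FockSpace n) :=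
  Finsupp.linearCombination ℂ fun u => ((√(u x : ℝ) : ℝ) : ℂ) • ket (u - Pi.single x 1)

/-- Position creation operator: `a_x† |u⟩ = √(u_x + 1) |u + 1_x⟩`. -/
def crePos {n : ℕ} (x : Bits n) : Module.End ℂ (FockSpace n) :=
  Finsupp.linearCombination ℂ fun u => ((√((u x : ℝ) + 1) : ℝ) : ℂ) • ket (u + Pi.single x 1)

/-- Momentum annihilation operator `2^{-n/2} ∑_x (-1)^{x·y} a_x`. -/
def annMom {n : ℕ} (y : Bits n) : Module.End ℂ (FockSpace n) :=
  (((√((2 : ℝ) ^ n))⁻¹ : ℝ) : ℂ) • ∑ x, sgn x y • annPos x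

/-- Momentum creation operator `2^{-n/2} ∑_x (-1)^{x·y} a_x†`. -/
def creMom {n : ℕ} (y : Bits n) : Module.End ℂ (FockSpace n) :=
  (((√((2 : ℝ) ^ n))⁻¹ : ℝ) : ℂ) • ∑ x, sgn x y • crePos x

theorem crePos_commute {n : ℕ} (x y : Bits n) : Commute (crePos x) (crePos y) := by
  rcases eq_or_ne x y with rfl | h
  · exact Commute.refl _
  · refine Finsupp.lhom_ext' fun u => LinearMap.ext_ring ?_
    simp only [crePos, ket, LinearMap.comp_apply, Module.End.mul_apply, Finsupp.lsingle_apply,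
      Finsupp.linearCombination_single, map_smul, Pi.add_apply,
      Pi.single_eq_of_ne h, Pi.single_eq_of_ne h.symm, add_zero, smul_smul]
    rw [mul_comm, add_right_comm]

theorem creMom_commute {n : ℕ} (x y : Bits n) : Commute (creMom x) (creMom y) := by
  unfold creMom
  refine Commute.smul_left (Commute.smul_right ?_ _) _
  refine Commute.sum_left _ _ _ fun s _ => Commute.sum_right _ _ _ fun t _ => ?_
  exact Commute.smul_left (Commute.smul_right (crePos_commute s t) _) _

/-- The momentum Fock state with `u x` bosons in momentum mode `x`:
`(∏_x u_x!)^{-1/2} ∏_x (creMom x)^{u_x} |vac⟩`. -/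
def momKet {n : ℕ} (u : Bits n → ℕ) : FockSpace n :=
  (((√((∏ x, (u x).factorial : ℕ) : ℝ))⁻¹ : ℝ) : ℂ) •
    (Finset.univ.noncommProd (fun x => creMom x ^ u x)
      fun x _ y _ _ => (creMom_commute x y).pow_pow (u x) (u y)) (vac n)

/-- The single-momentum hopping operator `ℓ^{-1/2} ∑_x creMom (x ⊕ y) · annMom x`. -/
def hopEnd {n : ℕ} (ℓ : ℕ) (y : Bits n) : Module.End ℂ (FockSpace n) :=
  (((√(ℓ : ℝ))⁻¹ : ℝ) : ℂ) • ∑ x, creMom (x + y) * annMom x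

/-! ### The space of exactly `ℓ` bosons (register `S`), in coordinates of the position Fock basis -/

/-- Occupation tuples of `ℓ` bosons, equivalently multisets of `n`-bit strings of size `ℓ`. -/
abbrev Occ (n ℓ : ℕ) : Type := {u : Bits n → ℕ // ∑ x, u x = ℓ}

instance instFintypeOcc (n ℓ : ℕ) : Fintype (Occ n ℓ) :=
  Fintype.subtype (Finset.univ.piAntidiag ℓ) (by simp)

/-- Coordinates of the `ℓ`-boson part of a state. -/
def coords {n : ℕ} (ℓ : ℕ) (φ : FockSpace n) : Occ n ℓ → ℂ := fun u => φ u.1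

/-- The hopping operator restricted to the space of `ℓ` bosons. -/
def hop {n : ℕ} (ℓ : ℕ) (y : Bits n) : Matrix (Occ n ℓ) (Occ n ℓ) ℂ :=
  Matrix.of fun u v => coords ℓ (hopEnd ℓ y (ket v.1)) u

/-- The projector onto `r`-condensates, i.e. onto the span of the momentum Fock states of `ℓ`
bosons with at least `ℓ - r` bosons in the zero-momentum mode. -/
def Con (n ℓ r : ℕ) : Matrix (Occ n ℓ) (Occ n ℓ) ℂ :=
  ∑ u : Occ n ℓ with ℓ ≤ u.1 0 + r,
    Matrix.vecMulVec (coords ℓ (momKet u.1)) (star (coords ℓ (momKet u.1)))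

/-- The initial state of `S`: all bosons in the zero-momentum mode, `(ℓ!)^{-1/2} (creMom 0)^ℓ |vac⟩`. -/
def initS (n ℓ : ℕ) : Occ n ℓ → ℂ :=
  coords ℓ ((((√(ℓ.factorial : ℝ))⁻¹ : ℝ) : ℂ) • (creMom (0 : Bits n) ^ ℓ) (vac n))

/-- `γ_y^{(S)} = (ℓ^{-1/2} ∑_{s ∈ S} (-1)^{y·s})²` for the multiset `S` with multiplicities `u`. -/
def gam {n ℓ : ℕ} (y : Bits n) (u : Occ n ℓ) : ℝ :=
  ((√(ℓ : ℝ))⁻¹ * ∑ x, (u.1 x : ℝ) * (-1) ^ (y ⬝ᵥ x).val) ^ 2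

/-- The functions `e_0(z) = 1 - exp(-κz)` and `e_1(z) = √(exp(-κz) (2 - exp(-κz)))`. -/
def eFun (κ : ℝ) (x : Bool) (z : ℝ) : ℝ :=
  if x then √(Real.exp (-κ * z) * (2 - Real.exp (-κ * z))) else 1 - Real.exp (-κ * z)

/-- The Kraus operator `E_x^{(y)} = ∑_S e_x(γ_y^{(S)}) |tt_S⟩⟨tt_S|`. -/
def kraus {n : ℕ} (ℓ : ℕ) (κ : ℝ) (x : Bool) (y : Bits n) : Matrix (Occ n ℓ) (Occ n ℓ) ℂ :=
  Matrix.diagonal fun u => ((eFun κ x (gam y u) : ℝ) : ℂ)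

/-- The sandwiched operator `Con_r · e_x(Con_R · G_y² · Con_R) · Con_r`, where `G_y` is the hopping
operator and `e_x` is applied to a Hermitian matrix by functional calculus. -/
def sandwich {n : ℕ} (ℓ : ℕ) (κ : ℝ) (r R : ℕ) (x : Bool) (y : Bits n) :
    Matrix (Occ n ℓ) (Occ n ℓ) ℂ :=
  Con n ℓ r * cfc (eFun κ x) (Con n ℓ R * hop ℓ y ^ 2 * Con n ℓ R) * Con n ℓ r

/-! ### The register `U`: one qubit `U_y` with basis `⊥` (`false`), `⊤` (`true`) for every `y` -/

abbrev URegister (n : ℕ) : Type := Bits n → Bool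

/-- Pauli `Z` on `U_y`, in the basis `⊥, ⊤`. -/
def pauliZ {n : ℕ} (y : Bits n) : Matrix (URegister n) (URegister n) ℂ :=
  Matrix.diagonal fun w => if w y then -1 else 1

/-- Pauli `X` on `U_y`, in the basis `⊥, ⊤`. -/
def pauliX {n : ℕ} (y : Bits n) : Matrix (URegister n) (URegister n) ℂ :=
  Matrix.of fun w' w => if w' = Function.update w y (!w y) then 1 else 0

/-- `K^0 = Z` and `K^1 = X`, acting on `U_y`. -/
def Kop {n : ℕ} (x : Bool) (y : Bits n) : Matrix (URegister n) (URegister n) ℂ :=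
  if x then pauliX y else pauliZ y

/-- `|⊥⟩^{⊗ 2^n}`. -/
def initU (n : ℕ) : URegister n → ℂ := Pi.single (fun _ => false) 1

/-! ### The register `A` of the algorithm: control bit, query string, `m` workspace qubits -/

abbrev ARegister (n m : ℕ) : Type := Bool × Bits n × (Fin m → Bool)

/-- The all-zero state. -/
def initA (n m : ℕ) : ARegister n m → ℂ := Pi.single (false, 0, fun _ => false) 1

/-- `|b, y⟩⟨b, y|` on the query register, identity on the workspace. -/
def queryProj {n : ℕ} (m : ℕ) (b : Bool) (y : Bits n) :
    Matrix (ARegister n m) (ARegister n m) ℂ :=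
  Matrix.diagonal fun a => if a.1 = b ∧ a.2.1 = y then 1 else 0

/-! ### States of a `T`-query algorithm -/

/-- `F (T-1) * ⋯ * F 1 * F 0`: the factor of the first query stands on the right. -/
def timeOrdered {ι : Type} [Fintype ι] [DecidableEq ι] {T : ℕ} (F : Fin T → Matrix ι ι ℂ) :
    Matrix ι ι ℂ :=
  (List.ofFn F).reverse.prod

/-- The product of `B x_i y_i` over the queries `i` with `b_i = 1`; the string `x` is indexed by
these queries. -/
def controlledProd {ι : Type} [Fintype ι] [DecidableEq ι] {n T : ℕ}
    (B : Bool → Bits n → Matrix ι ι ℂ) (y : Fin T → Bits n) (b : Fin T → Bool)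
    (x : {i : Fin T // b i = true} → Bool) : Matrix ι ι ℂ :=
  timeOrdered fun i => if h : b i = true then B (x ⟨i, h⟩) (y i) else 1

/-- `∑_{y,b} [A_{y,b} ⊗ ∑_x (K^x)_{y,b} ⊗ ∏_i B x_i y_i] A|0⟩|init⟩`,
where `A_{y,b} = ∏_{i=T}^{1} A |b_i,y_i⟩⟨b_i,y_i|`. -/
def algState {n m ℓ : ℕ} (T : ℕ) (A : Matrix (ARegister n m) (ARegister n m) ℂ)
    (B : Bool → Bits n → Matrix (Occ n ℓ) (Occ n ℓ) ℂ) :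
    EuclideanSpace ℂ (ARegister n m × (URegister n × Occ n ℓ)) :=
  WithLp.toLp 2 <| ∑ y : Fin T → Bits n, ∑ b : Fin T → Bool,
    (timeOrdered (fun i => A * queryProj m (b i) (y i)) ⊗ₖ
      ∑ x : {i : Fin T // b i = true} → Bool,
        controlledProd Kop y b x ⊗ₖ controlledProd B y b x) *ᵥ
      fun p => (A *ᵥ initA n m) p.1 * (initU n p.2.1 * initS n ℓ p.2.2)

/-- The post-query state of the algorithm. -/
def psiPQ {n m : ℕ} (ℓ : ℕ) (κ : ℝ) (T : ℕ) (A : Matrix (ARegister n m) (ARegister n m) ℂ) :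
    EuclideanSpace ℂ (ARegister n m × (URegister n × Occ n ℓ)) :=
  algState T A (kraus ℓ κ)

/-- The state in which every Kraus operator is replaced by its sandwiched version. -/
def psiSandwich {n m : ℕ} (ℓ : ℕ) (κ : ℝ) (T r R : ℕ)
    (A : Matrix (ARegister n m) (ARegister n m) ℂ) :
    EuclideanSpace ℂ (ARegister n m × (URegister n × Occ n ℓ)) :=
  algState T A (sandwich ℓ κ r R)

end BosonOracle

end

/-!
The exact evolution is unitary. Queries are block diagonal in the algorithm's register, and a query at
`y` is `Z ⊗ e₀(G²) + X ⊗ e₁(G²)` with `G` the hopping operator of `y`; it squares to the identity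
because `Z` and `X` anticommute and `e₀² + e₁² = 1`. The sandwiched queries are contractions for the
same reason. A hybrid argument therefore reduces the claim to two facts about a single query: it maps
condensates to slightly larger condensates up to a small error (`norm_oracle_leak_le`), and on
condensates it is close to the query built from the truncated operator `Con_R G² Con_R`
(`norm_oracle_sub_mul_conU_le`). The first fact follows from the second, since a truncated query
preserves `R`-condensates exactly.

For nonzero `y` the operator `G` excites at most one boson, and its norm on `k`-condensates is
`O(√k)` uniformly in the number `ℓ` of bosons (`norm_hop_mul_Con_le`, Schur's test in the momentum
Fock basis). So `Con_R G² Con_R` has spectrum in `[0, O(R)]`, and a polynomial of degree at most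
`(R - r) / 2` in it acts on `r`-condensates in the same way for all larger truncations. Both `e₀` and
`e₁` are superpositions of decaying exponentials `exp (-s z)` and are hence approximated on `[0, Λ]`
by polynomials of degree `D` up to an error `O(exp (-D / √Λ))` (`exists_polyApprox_eFun`); the square
root is the usual gain of Chebyshev expansions. Passing from `R` to `4 R`, `16 R`, ... until the
truncation is vacuous, the errors sum to `O(exp (-(R - r) / (26 √R)))`
(`norm_cfc_hop_sub_cfc_truncHop_le`). The mode `y = 0`, where `G` is the multiple `√ℓ` of the identity,
is treated exactly.

The error is small as soon as `√R - √r` is a large multiple `ρ` of the logarithm of the inverse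
precision. Each query thus raises the square root of the condensate radius by `ρ`, and after `T` queries
the radius is of order `ρ² T²` with `ρ = O(log T + log (1 / ι))`, which is within the claimed bounds.
-/


noncomputable section

namespace BosonOracle

/-! ### Low-degree polynomial approximation of the Kraus functions -/

/-- `f` is within `err` of a real polynomial of degree at most `D`, uniformly on `[0, Λ]`. -/
def PolyApprox (Λ D : ℝ) (f : ℝ → ℝ) (err : ℝ) : Prop :=
  ∃ p : Polynomial ℝ, (p.natDegree : ℝ) ≤ D ∧ ∀ z ∈ Set.Icc 0 Λ, |f z - p.eval z| ≤ err

theorem PolyApprox.mono {Λ D err err' : ℝ} {f : ℝ → ℝ} (h : PolyApprox Λ D f err)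
    (he : err ≤ err') : PolyApprox Λ D f err' :=
  let ⟨p, hp, hz⟩ := h
  ⟨p, hp, fun z hz' => (hz z hz').trans he⟩

theorem natDegree_sum_le_real {ι : Type*} {D : ℝ} (hD : 0 ≤ D) (s : Finset ι)
    (p : ι → Polynomial ℝ) (h : ∀ i ∈ s, ((p i).natDegree : ℝ) ≤ D) :
    ((∑ i ∈ s, p i).natDegree : ℝ) ≤ D := by
  have : (∑ i ∈ s, p i).natDegree ≤ ⌊D⌋₊ :=
    Polynomial.natDegree_sum_le_of_forall_le s p fun i hi => Nat.le_floor (h i hi)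
  exact (Nat.cast_le.2 this).trans (Nat.floor_le hD)

/-- Approximability is preserved by absolutely convergent superpositions, at the cost of an
arbitrarily small extra error that pays for cutting the series. -/
theorem PolyApprox.hasSum {Λ D E δ : ℝ} (hD : 0 ≤ D) {a : ℕ → ℝ} {f : ℕ → ℝ → ℝ} {F : ℝ → ℝ}
    {err : ℕ → ℝ} (h : ∀ k, PolyApprox Λ D (f k) (err k))
    (hb : ∀ k, ∀ z ∈ Set.Icc 0 Λ, |f k z| ≤ 1) (ha : Summable fun k => |a k|)
    (hF : ∀ z ∈ Set.Icc 0 Λ, HasSum (fun k => a k * f k z) (F z))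
    (hE : ∀ K, ∑ k ∈ Finset.range K, |a k| * err k ≤ E) (hδ : 0 < δ) :
    PolyApprox Λ D F (E + δ) := by
  choose p hp hpz using h
  obtain ⟨K, hK⟩ : ∃ K, ∑' k, |a (k + K)| < δ :=
    ((tendsto_order.1 (tendsto_sum_nat_add fun k => |a k|)).2 δ hδ).exists
  refine ⟨∑ k ∈ Finset.range K, Polynomial.C (a k) * p k,
    natDegree_sum_le_real hD _ _ fun k _ => le_trans ?_ (hp k), fun z hz => ?_⟩
  · exact_mod_cast Polynomial.natDegree_C_mul_le _ _
  · have hsum := (hF z hz).summable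
    have hab : ∀ k, |a k * f k z| ≤ |a k| := fun k => by
      rw [abs_mul]; exact mul_le_of_le_one_right (abs_nonneg _) (hb k z hz)
    have htail : |∑' k, a (k + K) * f (k + K) z| ≤ ∑' k, |a (k + K)| := by
      have hs := (summable_nat_add_iff K).2 ha
      have := tsum_of_norm_bounded hs.hasSum (f := fun k => a (k + K) * f (k + K) z)
        fun k => hab _
      simpa using this
    rw [← (hF z hz).tsum_eq, ← hsum.sum_add_tsum_nat_add K, Polynomial.eval_finsetSum,
      add_sub_right_comm, ← Finset.sum_sub_distrib]
    refine (abs_add_le _ _).trans (add_le_add ((Finset.abs_sum_le_sum_abs _ _).trans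
      (le_trans (Finset.sum_le_sum fun k _ => ?_) (hE K))) (htail.trans hK.le))
    rw [Polynomial.eval_mul, Polynomial.eval_C, ← mul_sub, abs_mul]
    exact mul_le_mul_of_nonneg_left (hpz k z hz) (abs_nonneg _)

theorem cos_pow_eq_sum (φ : ℝ) (k : ℕ) :
    Real.cos φ ^ k = ∑ j ∈ Finset.range (k + 1),
      (k.choose j : ℝ) / 2 ^ k * Real.cos (((2 * j - k : ℤ) : ℝ) * φ) := by
  have h1 : (Real.cos φ : ℂ) = (Complex.exp (φ * Complex.I) + Complex.exp (-φ * Complex.I)) / 2 := by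
    rw [Complex.ofReal_cos, Complex.cos]
  have h2 : ((Real.cos φ ^ k : ℝ) : ℂ) = ∑ j ∈ Finset.range (k + 1),
      (((k.choose j : ℝ) / 2 ^ k : ℝ) : ℂ) *
        Complex.exp (((((2 * j - k : ℤ) : ℝ) * φ : ℝ) : ℂ) * Complex.I) := by
    rw [Complex.ofReal_pow, h1, div_pow, add_pow, Finset.sum_div]
    refine Finset.sum_congr rfl fun j hj => ?_
    have hj' : j ≤ k := Nat.lt_succ_iff.1 (Finset.mem_range.1 hj)
    rw [← Complex.exp_nat_mul, ← Complex.exp_nat_mul, ← Complex.exp_add]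
    push_cast [hj']
    rw [show (j : ℂ) * (φ * Complex.I) + (k - j) * (-φ * Complex.I)
      = (2 * j - k) * φ * Complex.I by ring]
    ring
  have h3 := congrArg Complex.re h2
  rw [Complex.ofReal_re, Complex.re_sum] at h3
  rw [h3]
  exact Finset.sum_congr rfl fun j _ => by rw [Complex.re_ofReal_mul, Complex.exp_ofReal_mul_I_re]

theorem cosh_pow_eq_sum (θ : ℝ) (k : ℕ) :
    Real.cosh θ ^ k = ∑ j ∈ Finset.range (k + 1),
      (k.choose j : ℝ) / 2 ^ k * Real.cosh (((2 * j - k : ℤ) : ℝ) * θ) := by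
  have key : ∀ t : ℝ, Real.cosh t ^ k = ∑ j ∈ Finset.range (k + 1),
      (k.choose j : ℝ) / 2 ^ k * Real.exp (((2 * j - k : ℤ) : ℝ) * t) := fun t => by
    rw [Real.cosh_eq, div_pow, add_pow, Finset.sum_div]
    refine Finset.sum_congr rfl fun j hj => ?_
    have hj' : j ≤ k := Nat.lt_succ_iff.1 (Finset.mem_range.1 hj)
    rw [← Real.exp_nat_mul, ← Real.exp_nat_mul, ← Real.exp_add]
    push_cast [hj']
    rw [show (j : ℝ) * t + (k - j) * -t = (2 * j - k) * t by ring]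
    ring
  have h1 := key θ
  have h2 := key (-θ)
  rw [Real.cosh_neg] at h2
  rw [← add_self_div_two (Real.cosh θ ^ k)]
  nth_rewrite 1 [h1]
  rw [h2, ← Finset.sum_add_distrib, Finset.sum_div]
  refine Finset.sum_congr rfl fun j _ => ?_
  rw [Real.cosh_eq, mul_neg]
  ring

theorem natDegree_chebyshev_T_le (m : ℤ) : (Polynomial.Chebyshev.T ℝ m).natDegree ≤ m.natAbs :=
  Polynomial.natDegree_le_of_degree_le (by simp)

/-- Truncating the Chebyshev expansion of a monomial in `x = 1 - 2 z / Λ`. The expansion is the law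
of a simple random walk, so the discarded mass obeys a Chernoff bound. -/
theorem polyApprox_pow {Λ D θ : ℝ} (hΛ : 0 < Λ) (hD : 0 ≤ D) (hθ : 0 ≤ θ) (k : ℕ) :
    PolyApprox Λ D (fun z => (1 - 2 * z / Λ) ^ k)
      (2 * Real.exp (-θ * D) * Real.cosh θ ^ k) := by
  classical
  set q : Polynomial ℝ := 1 - Polynomial.C (2 / Λ) * Polynomial.X with hq
  have hqd : q.natDegree ≤ 1 := by
    rw [hq]
    compute_degree
  let m : ℕ → ℤ := fun j => 2 * j - k
  have hw : ∀ j, 0 ≤ (k.choose j : ℝ) / 2 ^ k := fun j => by positivity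
  refine ⟨∑ j ∈ Finset.range (k + 1) with ((m j).natAbs : ℝ) ≤ D,
    Polynomial.C ((k.choose j : ℝ) / 2 ^ k) * (Polynomial.Chebyshev.T ℝ (m j)).comp q,
    natDegree_sum_le_real hD _ _ fun j hj => ?_, fun z hz => ?_⟩
  · refine le_trans ?_ (Finset.mem_filter.1 hj).2
    refine Nat.cast_le.2 ((Polynomial.natDegree_C_mul_le _ _).trans ?_)
    refine Polynomial.natDegree_comp_le.trans ?_
    calc _ ≤ (m j).natAbs * 1 := Nat.mul_le_mul (natDegree_chebyshev_T_le _) hqd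
      _ = _ := mul_one _
  · set x : ℝ := 1 - 2 * z / Λ with hx
    have hqz : q.eval z = x := by simp [hq, hx]; ring
    have h0 : 0 ≤ 2 * z / Λ := by have := hz.1; positivity
    have h2 : 2 * z / Λ ≤ 2 := by
      rw [div_le_iff₀ hΛ]; linarith [hz.2]
    have hcos : Real.cos (Real.arccos x) = x := Real.cos_arccos (by linarith) (by linarith)
    set φ := Real.arccos x
    have hev : ∀ j, (Polynomial.C ((k.choose j : ℝ) / 2 ^ k) *
        (Polynomial.Chebyshev.T ℝ (m j)).comp q).eval z
        = (k.choose j : ℝ) / 2 ^ k * Real.cos ((m j : ℝ) * φ) := fun j => by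
      rw [Polynomial.eval_mul, Polynomial.eval_C, Polynomial.eval_comp, hqz, ← hcos,
        Polynomial.Chebyshev.T_real_cos]
    rw [Polynomial.eval_finsetSum]
    simp only [hev]
    rw [← hx, ← hcos, cos_pow_eq_sum φ k,
      ← Finset.sum_filter_add_sum_filter_not (Finset.range (k + 1))
        (fun j => ((m j).natAbs : ℝ) ≤ D), add_sub_cancel_left, cosh_pow_eq_sum, Finset.mul_sum]
    refine (Finset.abs_sum_le_sum_abs _ _).trans ?_
    refine le_trans (Finset.sum_le_sum fun j hj => ?_)
      (Finset.sum_le_sum_of_subset_of_nonneg (Finset.filter_subset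
        (fun j => ¬ ((m j).natAbs : ℝ) ≤ D) _) fun j _ _ => ?_)
    · have hjD : D < |(m j : ℝ)| := by
        have := (Finset.mem_filter.1 hj).2
        rw [not_le, Nat.cast_natAbs] at this
        exact_mod_cast this
      rw [abs_mul, abs_of_nonneg (hw j), mul_left_comm]
      refine mul_le_mul_of_nonneg_left ((Real.abs_cos_le_one _).trans ?_) (hw j)
      have hc : Real.cosh ((m j : ℝ) * θ) = Real.cosh (|(m j : ℝ)| * θ) := by
        rw [← Real.cosh_abs, abs_mul, abs_of_nonneg hθ]
      change 1 ≤ 2 * Real.exp (-θ * D) * Real.cosh ((m j : ℝ) * θ)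
      rw [hc, Real.cosh_eq]
      have e1 : 1 ≤ Real.exp (-θ * D) * Real.exp (|(m j : ℝ)| * θ) := by
        rw [← Real.exp_add]
        exact Real.one_le_exp (by nlinarith)
      have e2 : 0 ≤ Real.exp (-θ * D) * Real.exp (-(|(m j : ℝ)| * θ)) := by positivity
      nlinarith
    · have := Real.cosh_pos (((2 * j - k : ℤ) : ℝ) * θ)
      have := hw j
      positivity

/-- Expanding `exp (-s z)` in powers of `x = 1 - 2 z / Λ` and truncating each power. The rate
`1 / √Λ` is the one for which the growth `cosh (1 / √Λ)` of the truncation error per power is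
compensated, up to `exp (s / 2)`, over the typical number `s Λ / 2` of powers. -/
theorem polyApprox_exp {Λ D s : ℝ} (hΛ : 1 ≤ Λ) (hD : 0 ≤ D) (hs : 0 ≤ s) :
    PolyApprox Λ D (fun z => Real.exp (-s * z)) (3 * Real.exp (s / 2 - D / √Λ)) := by
  have hΛ0 : 0 < Λ := by linarith
  have hsq : 0 < √Λ := Real.sqrt_pos.2 hΛ0
  set θ : ℝ := 1 / √Λ with hθ
  have hθ0 : 0 ≤ θ := by positivity
  have hθ2 : θ ^ 2 = 1 / Λ := by rw [hθ, div_pow, Real.sq_sqrt hΛ0.le, one_pow]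
  have hθ1 : θ ^ 2 ≤ 1 := by rw [hθ2]; exact (div_le_one hΛ0).2 hΛ
  set lam : ℝ := s * Λ / 2 with hlam
  have hlam0 : 0 ≤ lam := by positivity
  have hcosh : Real.cosh θ - 1 ≤ θ ^ 2 := by
    have h1 := Real.cosh_le_exp_half_sq θ
    have h2 := (le_abs_self _).trans (Real.abs_exp_sub_one_le (x := θ ^ 2 / 2)
      (by rw [abs_of_nonneg (by positivity)]; linarith))
    rw [abs_of_nonneg (by positivity)] at h2
    linarith
  have hexp : ∀ x : ℝ, HasSum (fun k : ℕ => x ^ k / k.factorial) (Real.exp x) := fun x => by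
    rw [Real.exp_eq_exp_ℝ]; exact NormedSpace.expSeries_div_hasSum_exp x
  have hmain := PolyApprox.hasSum (δ := Real.exp (s / 2 - D / √Λ)) (F := fun z => Real.exp (-s * z))
    (E := 2 * Real.exp (s / 2 - D / √Λ)) hD (a := fun k : ℕ => Real.exp (-lam) * (lam ^ k / k.factorial))
    (fun k => polyApprox_pow hΛ0 hD hθ0 k) (fun k z hz => ?_) ?_ (fun z hz => ?_) (fun K => ?_)
    (Real.exp_pos _)
  · convert hmain using 1
    ring
  · have h0 : 0 ≤ 2 * z / Λ := by have := hz.1; positivity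
    have h2 : 2 * z / Λ ≤ 2 := by
      rw [div_le_iff₀ hΛ0]; linarith [hz.2]
    rw [abs_pow]
    exact pow_le_one₀ (abs_nonneg _) (abs_le.2 ⟨by linarith, by linarith⟩)
  · exact ((hexp lam).summable.mul_left _).abs
  · have := (hexp (lam * (1 - 2 * z / Λ))).mul_left (Real.exp (-lam))
    rw [← Real.exp_add, show -lam + lam * (1 - 2 * z / Λ) = -s * z by
      rw [hlam]; field_simp; ring] at this
    refine this.congr_fun ?_
    intro k
    rw [mul_pow]; ring
  · have h1 : ∀ k ∈ Finset.range K, |Real.exp (-lam) * (lam ^ k / k.factorial)| *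
        (2 * Real.exp (-θ * D) * Real.cosh θ ^ k) = 2 * Real.exp (-θ * D) * Real.exp (-lam) *
          ((lam * Real.cosh θ) ^ k / k.factorial) := fun k _ => by
      rw [abs_of_nonneg (by positivity), mul_pow]; ring
    rw [Finset.sum_congr rfl h1, ← Finset.mul_sum]
    have h2 : ∑ k ∈ Finset.range K, (lam * Real.cosh θ) ^ k / (k.factorial : ℝ)
        ≤ Real.exp (lam * Real.cosh θ) :=
      sum_le_hasSum _ (fun k _ => by have := Real.cosh_pos θ; positivity) (hexp _)
    calc _ ≤ 2 * Real.exp (-θ * D) * Real.exp (-lam) * Real.exp (lam * Real.cosh θ) := by gcongr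
      _ = 2 * Real.exp (lam * (Real.cosh θ - 1) - D / √Λ) := by
        rw [mul_assoc, mul_assoc, ← Real.exp_add, ← Real.exp_add, hθ]; ring_nf
      _ ≤ _ := by
        gcongr
        calc lam * (Real.cosh θ - 1) ≤ lam * θ ^ 2 := by gcongr
          _ = s / 2 := by rw [hθ2, hlam]; field_simp

/-- The binomial series of `√(1 - w/2)`; its coefficients decay fast enough to beat `exp (k/2)`,
because `exp (1/2) < 2`. -/
theorem exists_sqrt_series : ∃ c : ℕ → ℝ, (Summable fun k : ℕ => |c k| * Real.exp (k / 2)) ∧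
    ∀ w : ℝ, 0 ≤ w → w ≤ 1 → HasSum (fun k => c k * w ^ k) (√(1 - w / 2)) := by
  have hser := Real.one_add_rpow_hasFPowerSeriesOnBall_zero (a := 1 / 2)
  have he : Real.exp (1 / 2) < 2 := by
    have := Real.exp_one_lt_d9
    have h2 : Real.exp (1 / 2) ^ 2 = Real.exp 1 := by rw [← Real.exp_nat_mul]; norm_num
    nlinarith [Real.exp_pos (1 / 2 : ℝ)]
  refine ⟨fun k => Ring.choose (1 / 2 : ℝ) k * (-1 / 2) ^ k, ?_, fun w hw0 hw1 => ?_⟩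
  · let ρ : NNReal := ⟨Real.exp (1 / 2) / 2, by positivity⟩
    have hρ : (ρ : ENNReal) < (binomialSeries ℝ (1 / 2 : ℝ)).radius :=
      lt_of_lt_of_le (by
        rw [← ENNReal.coe_one, ENNReal.coe_lt_coe, ← NNReal.coe_lt_coe]
        change Real.exp (1 / 2) / 2 < 1
        linarith) hser.r_le
    refine ((binomialSeries ℝ (1 / 2 : ℝ)).summable_norm_mul_pow hρ).congr fun k => ?_
    have hn : ‖binomialSeries ℝ (1 / 2 : ℝ) k‖ = |Ring.choose (1 / 2 : ℝ) k| := by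
      simp [binomialSeries]
    rw [hn, abs_mul, abs_pow, mul_assoc]
    congr 1
    change (Real.exp (1 / 2) / 2) ^ k = _
    rw [div_pow, ← Real.exp_nat_mul, show (k : ℝ) * (1 / 2) = k / 2 by ring]
    rw [show |(-1 / 2 : ℝ)| = 1 / 2 by norm_num [abs_div], div_pow, one_pow]
    ring
  · have hmem : (-w / 2) ∈ Metric.eball (0 : ℝ) 1 := by
      rw [← ENNReal.ofReal_one, Metric.eball_ofReal]
      simp only [Metric.mem_ball, dist_zero_right, Real.norm_eq_abs]
      rw [abs_lt]; constructor <;> linarith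
    have := hser.hasSum hmem
    simp only [zero_add, binomialSeries_apply, List.prod_ofFn, Finset.prod_const,
      Finset.card_univ, Fintype.card_fin, smul_eq_mul] at this
    rw [show 1 + -w / 2 = 1 - w / 2 by ring, ← Real.sqrt_eq_rpow] at this
    refine this.congr_fun ?_
    intro k
    rw [mul_assoc, ← mul_pow]
    ring_nf

/-- Polynomial approximation of `e_0` and `e_1` with a constant independent of `κ ∈ [0, 1]`. The
degree needed for a fixed precision grows only like the square root of the interval length, since
both functions are superpositions of decaying exponentials: `e_1(z)` is
`√2 exp (-κ z / 2) √(1 - w / 2)` with `w = exp (-κ z)`. -/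
theorem exists_polyApprox_eFun : ∃ M : ℝ, 0 < M ∧ ∀ (κ : ℝ) (x : Bool) (Λ D : ℝ), 0 ≤ κ → κ ≤ 1 →
    1 ≤ Λ → 0 ≤ D → PolyApprox Λ D (eFun κ x) (M * Real.exp (-(D / √Λ))) := by
  obtain ⟨c, hc, hcs⟩ := exists_sqrt_series
  set S := ∑' k : ℕ, |c k| * Real.exp (k / 2)
  have hS : 0 ≤ S := tsum_nonneg fun k => by positivity
  -- `6` serves `e_0`, the second summand the series of `e_1`, and `1` the cut of that series
  refine ⟨6 + √2 * 3 * Real.exp (1 / 4) * S + 1, by positivity, fun κ x Λ D hκ hκ1 hΛ hD => ?_⟩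
  have hpos := Real.exp_pos (-(D / √Λ))
  cases x
  · obtain ⟨p, hp, hz⟩ := polyApprox_exp hΛ hD hκ
    refine PolyApprox.mono (err := 3 * Real.exp (κ / 2 - D / √Λ)) ⟨1 - p, ?_, fun z hz' => ?_⟩ ?_
    · refine le_trans ?_ hp
      exact_mod_cast (Polynomial.natDegree_sub_le _ _).trans (by simp)
    · have := hz z hz'
      simp only [eFun, Polynomial.eval_sub, Polynomial.eval_one]
      rw [if_neg (by simp), sub_sub_sub_cancel_left, abs_sub_comm]
      exact this
    · have h1 : Real.exp (κ / 2) ≤ 2 := by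
        have := Real.exp_one_lt_d9
        have h2 : Real.exp (1 / 2) ^ 2 = Real.exp 1 := by rw [← Real.exp_nat_mul]; norm_num
        have h3 : Real.exp (κ / 2) ≤ Real.exp (1 / 2) := Real.exp_le_exp.2 (by linarith)
        nlinarith [Real.exp_pos (1 / 2 : ℝ)]
      rw [sub_eq_add_neg, Real.exp_add, ← mul_assoc]
      refine mul_le_mul_of_nonneg_right ?_ hpos.le
      have : 0 ≤ √2 * 3 * Real.exp (1 / 4) * S := by positivity
      linarith
  · have hterm : ∀ k : ℕ, 0 ≤ κ * (k + 1 / 2) := fun k => by positivity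
    have hmain := PolyApprox.hasSum (δ := Real.exp (-(D / √Λ))) (F := eFun κ true)
      (E := √2 * 3 * Real.exp (1 / 4) * S * Real.exp (-(D / √Λ))) hD
      (a := fun k : ℕ => √2 * c k) (fun k => polyApprox_exp hΛ hD (hterm k))
      (fun k z hz => ?_) ?_ (fun z hz => ?_) (fun K => ?_) hpos
    · exact hmain.mono (by nlinarith)
    · rw [abs_of_nonneg (Real.exp_pos _).le]
      exact Real.exp_le_one_iff.2 (by have := hterm k; have := hz.1; nlinarith)
    · refine Summable.of_nonneg_of_le (fun k => abs_nonneg _) (fun k => ?_) (hc.mul_left √2)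
      rw [abs_mul, abs_of_nonneg (Real.sqrt_nonneg 2)]
      have : 1 ≤ Real.exp ((k : ℝ) / 2) := Real.one_le_exp (by positivity)
      gcongr
      exact le_mul_of_one_le_right (abs_nonneg _) this
    · set w := Real.exp (-κ * z) with hw
      have hw1 : w ≤ 1 := Real.exp_le_one_iff.2 (by have := hz.1; nlinarith)
      have h1 := (hcs w (Real.exp_pos _).le hw1).mul_left (√2 * Real.exp (-(κ / 2) * z))
      have h2 : eFun κ true z = √2 * Real.exp (-(κ / 2) * z) * √(1 - w / 2) := by
        have hhalf : Real.exp (-(κ / 2) * z) = √w := by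
          rw [hw, Real.sqrt_eq_rpow, ← Real.exp_mul]; ring_nf
        simp only [eFun, if_true]
        rw [hhalf, ← Real.sqrt_mul (by norm_num), ← Real.sqrt_mul (by positivity)]
        congr 1; ring
      rw [h2]
      refine h1.congr_fun ?_
      intro k
      rw [show -(κ * (k + 1 / 2)) * z = -(κ / 2) * z + k * (-κ * z) by ring, Real.exp_add,
        Real.exp_nat_mul]
      ring
    · have h1 : ∀ k ∈ Finset.range K, |√2 * c k| *
          (3 * Real.exp (κ * (k + 1 / 2) / 2 - D / √Λ)) ≤
          √2 * 3 * Real.exp (1 / 4) * Real.exp (-(D / √Λ)) * (|c k| * Real.exp (k / 2)) := by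
        intro k _
        rw [abs_mul, abs_of_nonneg (Real.sqrt_nonneg 2)]
        have h3 : Real.exp (κ * (k + 1 / 2) / 2 - D / √Λ) ≤
            Real.exp (1 / 4) * Real.exp (-(D / √Λ)) * Real.exp (k / 2) := by
          rw [← Real.exp_add, ← Real.exp_add]
          refine Real.exp_le_exp.2 ?_
          have hk : (0 : ℝ) ≤ k := Nat.cast_nonneg k
          nlinarith
        calc _ ≤ √2 * |c k| * (3 * (Real.exp (1 / 4) * Real.exp (-(D / √Λ)) * Real.exp (k / 2))) := by
              gcongr
          _ = _ := by ring
      refine (Finset.sum_le_sum h1).trans ?_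
      rw [← Finset.mul_sum]
      have h2 : ∑ k ∈ Finset.range K, |c k| * Real.exp ((k : ℝ) / 2) ≤ S :=
        hc.sum_le_tsum _ fun k _ => by positivity
      calc _ ≤ √2 * 3 * Real.exp (1 / 4) * Real.exp (-(D / √Λ)) * S := by gcongr
        _ = _ := by ring

section

/-! ### Momentum Fock states -/

variable {n : ℕ}

theorem neg_one_pow_val_add {R : Type*} [Ring R] (a b : ZMod 2) :
    ((-1 : R)) ^ (a + b).val = (-1) ^ a.val * (-1) ^ b.val := by
  have : (a + b).val % 2 = (a.val + b.val) % 2 := by revert a b; decide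
  rw [← pow_add, neg_one_pow_eq_pow_mod_two, this, ← neg_one_pow_eq_pow_mod_two]

theorem sgn_add_right (s x y : Bits n) : sgn s (x + y) = sgn s x * sgn s y := by
  rw [sgn, dotProduct_add, neg_one_pow_val_add, sgn, sgn]

theorem sgn_comm (x y : Bits n) : sgn x y = sgn y x := by rw [sgn, sgn, dotProduct_comm]

theorem sgn_zero_right (s : Bits n) : sgn s 0 = 1 := by simp [sgn]

theorem bits_add_self (x : Bits n) : x + x = 0 := by
  funext i; exact CharTwo.add_self_eq_zero (x i)

theorem bits_add_eq_zero {x y : Bits n} : x + y = 0 ↔ x = y := by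
  constructor
  · intro h
    rw [← add_zero x, ← bits_add_self y, ← add_assoc, h, zero_add]
  · rintro rfl; exact bits_add_self _

/-- Orthogonality of the characters of `{0,1}^n`. -/
theorem sum_sgn (z : Bits n) : ∑ s, sgn s z = if z = 0 then (2 : ℂ) ^ n else 0 := by
  split_ifs with h
  · subst h
    simp [sgn_zero_right, ZMod.card]
  · obtain ⟨i, hi⟩ := Function.ne_iff.1 h
    have hi1 : z i = 1 := by
      have : ∀ a : ZMod 2, a ≠ 0 → a = 1 := by decide
      exact this _ hi
    obtain ⟨e, he⟩ : ∃ e : Bits n, sgn z e = -1 := ⟨Pi.single i 1, by simp [sgn, hi1, ZMod.val_one]⟩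
    have hflip : ∀ s : Bits n, sgn (s + e) z = - sgn s z := fun s => by
      rw [sgn_comm, sgn_add_right, sgn_comm z s, he]
      ring
    have h1 : ∑ s, sgn s z = ∑ s : Bits n, sgn (s + e) z :=
      (Equiv.sum_comp (Equiv.addRight e) fun s => sgn s z).symm
    simp only [hflip, Finset.sum_neg_distrib] at h1
    linear_combination h1 / 2

theorem sum_sgn_mul_sgn (x y : Bits n) :
    ∑ s, sgn s x * sgn s y = if x = y then (2 : ℂ) ^ n else 0 := by
  simp only [← sgn_add_right, sum_sgn, bits_add_eq_zero]

theorem annPos_ket (x : Bits n) (u : Bits n → ℕ) :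
    annPos x (ket u) = ((√(u x : ℝ) : ℝ) : ℂ) • ket (u - Pi.single x 1) := by
  simp [annPos, ket, Finsupp.linearCombination_single]

theorem crePos_ket (x : Bits n) (u : Bits n → ℕ) :
    crePos x (ket u) = ((√((u x : ℝ) + 1) : ℝ) : ℂ) • ket (u + Pi.single x 1) := by
  simp [crePos, ket, Finsupp.linearCombination_single]

theorem sub_single_add_single {u : Bits n → ℕ} {x : Bits n} (h : u x ≠ 0) :
    u - Pi.single x 1 + Pi.single x 1 = u := by
  funext z
  rcases eq_or_ne z x with rfl | hz
  · simp only [Pi.add_apply, Pi.sub_apply, Pi.single_eq_same]; omega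
  · simp [hz]

theorem add_single_sub_single (u : Bits n → ℕ) (x : Bits n) :
    u + Pi.single x 1 - Pi.single x 1 = u := by
  funext z; simp

theorem fock_ext {f g : FockSpace n →ₗ[ℂ] ℂ} (h : ∀ u, f (ket u) = g (ket u)) : f = g :=
  Finsupp.lhom_ext' fun u => LinearMap.ext_ring (h u)

/-- Creation in coordinates; the coefficient vanishes exactly where the truncated subtraction is
meaningless. -/
theorem crePos_apply (x : Bits n) (φ : FockSpace n) (w : Bits n → ℕ) :
    crePos x φ w = ((√(w x : ℝ) : ℝ) : ℂ) * φ (w - Pi.single x 1) := by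
  suffices h : Finsupp.lapply w ∘ₗ crePos x
      = ((√(w x : ℝ) : ℝ) : ℂ) • Finsupp.lapply (w - Pi.single x 1 : Bits n → ℕ) from
    LinearMap.congr_fun h φ
  refine fock_ext fun u => ?_
  rw [LinearMap.comp_apply, crePos_ket]
  simp only [map_smul, Finsupp.lapply_apply, LinearMap.smul_apply, smul_eq_mul, ket,
    Finsupp.single_apply]
  by_cases hw : u + Pi.single x 1 = w
  · subst hw
    simp
  · rw [if_neg hw, mul_zero]
    split_ifs with h
    · have : w x = 0 := by
        by_contra h0
        exact hw (by rw [h, sub_single_add_single h0])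
      simp [this]
    · simp

theorem annPos_apply (x : Bits n) (φ : FockSpace n) (w : Bits n → ℕ) :
    annPos x φ w = ((√((w x : ℝ) + 1) : ℝ) : ℂ) * φ (w + Pi.single x 1) := by
  suffices h : Finsupp.lapply w ∘ₗ annPos x
      = ((√((w x : ℝ) + 1) : ℝ) : ℂ) • Finsupp.lapply (w + Pi.single x 1 : Bits n → ℕ) from
    LinearMap.congr_fun h φ
  refine fock_ext fun u => ?_
  rw [LinearMap.comp_apply, annPos_ket]
  simp only [map_smul, Finsupp.lapply_apply, LinearMap.smul_apply, smul_eq_mul, ket,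
    Finsupp.single_apply]
  by_cases hw : u = w + Pi.single x 1
  · subst hw
    simp
  · rw [if_neg hw, mul_zero]
    split_ifs with h
    · have : u x = 0 := by
        by_contra h0
        exact hw (by rw [← h, sub_single_add_single h0])
      simp [this]
    · simp

theorem crePos_annPos_apply (x : Bits n) (φ : FockSpace n) (w : Bits n → ℕ) :
    crePos x (annPos x φ) w = (w x : ℂ) * φ w := by
  rw [crePos_apply, annPos_apply, ← mul_assoc]
  by_cases h : w x = 0
  · simp [h]
  · rw [sub_single_add_single h]
    congr 1
    have h1 : (((w - Pi.single x 1 : Bits n → ℕ) x : ℕ) : ℝ) + 1 = w x := by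
      simp only [Pi.sub_apply, Pi.single_eq_same]
      exact_mod_cast Nat.succ_pred_eq_of_ne_zero h
    rw [h1, ← Complex.ofReal_mul, Real.mul_self_sqrt (Nat.cast_nonneg _), Complex.ofReal_natCast]

theorem annPos_mul_crePos (x y : Bits n) :
    annPos x * crePos y = crePos y * annPos x + (if x = y then 1 else 0) := by
  refine LinearMap.ext fun φ => Finsupp.ext fun w => ?_
  rw [LinearMap.add_apply, Finsupp.add_apply, Module.End.mul_apply, Module.End.mul_apply]
  rcases eq_or_ne x y with rfl | h
  · rw [crePos_annPos_apply, annPos_apply, crePos_apply, add_single_sub_single, if_pos rfl,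
      ← mul_assoc, ← Complex.ofReal_mul]
    have : √((w x : ℝ) + 1) * √(((w + Pi.single x 1 : Bits n → ℕ) x : ℕ) : ℝ) = w x + 1 := by
      rw [Pi.add_apply, Pi.single_eq_same, Nat.cast_add, Nat.cast_one,
        Real.mul_self_sqrt (by positivity)]
    rw [this, Module.End.one_apply]
    push_cast; ring
  · rw [if_neg h, LinearMap.zero_apply, Finsupp.zero_apply, add_zero, annPos_apply, crePos_apply,
      crePos_apply, annPos_apply]
    have h1 : (w + Pi.single x 1 : Bits n → ℕ) y = w y := by simp [h.symm]
    have h2 : (w - Pi.single y 1 : Bits n → ℕ) x = w x := by simp [h]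
    by_cases hy : w y = 0
    · simp [h1, hy]
    · have h3 : w + Pi.single x 1 - Pi.single y 1 = w - Pi.single y 1 + Pi.single x 1 := by
        funext z
        rcases eq_or_ne z x with rfl | hz
        · simp [h]
        · simp [hz]
      rw [h1, h2, h3]; ring

theorem mode_norm_sq (n : ℕ) : (((√((2 : ℝ) ^ n))⁻¹ : ℝ) : ℂ) * (((√((2 : ℝ) ^ n))⁻¹ : ℝ) : ℂ)
    * (2 : ℂ) ^ n = 1 := by
  have h : (√((2 : ℝ) ^ n))⁻¹ * (√((2 : ℝ) ^ n))⁻¹ * (2 : ℝ) ^ n = 1 := by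
    rw [← mul_inv, Real.mul_self_sqrt (by positivity)]
    exact inv_mul_cancel₀ (by positivity)
  exact_mod_cast congrArg (fun t : ℝ => (t : ℂ)) h

/-- Canonical commutation relations pass to linear combinations. -/
theorem sum_smul_mul_sum_smul_of_ccr {E ι : Type*} [Ring E] [Algebra ℂ E] [Fintype ι]
    [DecidableEq ι] {a b : ι → E} (h : ∀ s t, a s * b t = b t * a s + (if s = t then 1 else 0))
    (f g : ι → ℂ) :
    (∑ s, f s • a s) * (∑ t, g t • b t)
      = (∑ t, g t • b t) * (∑ s, f s • a s) + (∑ s, f s * g s) • (1 : E) := by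
  rw [Finset.sum_mul_sum, Finset.sum_mul_sum, Finset.sum_smul]
  simp only [smul_mul_smul_comm, h, smul_add, Finset.sum_add_distrib]
  congr 1
  · rw [Finset.sum_comm]
    simp only [mul_comm]
  · simp

theorem annMom_mul_creMom (x y : Bits n) :
    annMom x * creMom y = creMom y * annMom x + (if x = y then 1 else 0) := by
  have h := sum_smul_mul_sum_smul_of_ccr (E := Module.End ℂ (FockSpace n)) annPos_mul_crePos
    (fun s => sgn s x) (fun s => sgn s y)
  rw [annMom, creMom, smul_mul_smul_comm, smul_mul_smul_comm, h, smul_add, sum_sgn_mul_sgn, smul_smul]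
  congr 1
  split_ifs
  · rw [mode_norm_sq, one_smul]
  · simp

/-- The bilinear pairing `∑_u φ_u ψ_u`. It agrees with the Hilbert space inner product on vectors
with real coordinates, such as the momentum Fock states. -/
def pairing : FockSpace n →ₗ[ℂ] FockSpace n →ₗ[ℂ] ℂ :=
  Finsupp.linearCombination ℂ fun u => Finsupp.lapply u

theorem pairing_ket_left (u : Bits n → ℕ) (ψ : FockSpace n) : pairing (ket u) ψ = ψ u := by
  simp [pairing, ket, Finsupp.linearCombination_single]

theorem pairing_comm (φ ψ : FockSpace n) : pairing φ ψ = pairing ψ φ := by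
  suffices h : (pairing : FockSpace n →ₗ[ℂ] FockSpace n →ₗ[ℂ] ℂ) = pairing.flip from
    LinearMap.congr_fun₂ h φ ψ
  refine Finsupp.lhom_ext' fun u => LinearMap.ext_ring (fock_ext fun v => ?_)
  change pairing (ket u) (ket v) = pairing (ket v) (ket u)
  rw [pairing_ket_left, pairing_ket_left, ket, ket, Finsupp.single_apply, Finsupp.single_apply]
  simp only [eq_comm]

theorem pairing_eq_sum (s : Finset (Bits n → ℕ)) (φ ψ : FockSpace n) (h : ∀ u ∉ s, φ u = 0) :
    pairing φ ψ = ∑ u ∈ s, φ u * ψ u := by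
  rw [pairing, Finsupp.linearCombination_apply, Finsupp.sum_of_support_subset (s := s) _
    (fun u hu => by_contra fun hs => Finsupp.mem_support_iff.1 hu (h u hs)) _ (by simp)]
  simp

theorem pairing_crePos (x : Bits n) (φ ψ : FockSpace n) :
    pairing (crePos x φ) ψ = pairing φ (annPos x ψ) := by
  suffices h : pairing ∘ₗ crePos x = pairing.compl₂ (annPos x) from LinearMap.congr_fun₂ h φ ψ
  refine Finsupp.lhom_ext' fun u => LinearMap.ext_ring (LinearMap.ext fun ψ => ?_)
  change pairing (crePos x (ket u)) ψ = pairing (ket u) (annPos x ψ)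
  rw [crePos_ket, map_smul, LinearMap.smul_apply, pairing_ket_left, pairing_ket_left,
    annPos_apply, smul_eq_mul]

theorem pairing_creMom (x : Bits n) (φ ψ : FockSpace n) :
    pairing (creMom x φ) ψ = pairing φ (annMom x ψ) := by
  simp only [creMom, annMom, LinearMap.smul_apply, LinearMap.sum_apply, map_smul, map_sum,
    pairing_crePos]

theorem occupation_induction {p : (Bits n → ℕ) → Prop} (h0 : p 0)
    (hs : ∀ u x, p u → p (u + Pi.single x 1)) (u : Bits n → ℕ) : p u := by
  induction h : ∑ x, u x generalizing u with
  | zero =>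
    have : u = 0 := funext fun x => (Finset.sum_eq_zero_iff.1 h) x (Finset.mem_univ x)
    exact this ▸ h0
  | succ k ih =>
    obtain ⟨x, -, hx⟩ := Finset.exists_ne_zero_of_sum_ne_zero (h.trans_ne (Nat.succ_ne_zero k))
    rw [← sub_single_add_single hx]
    refine hs _ _ (ih _ ?_)
    have h2 := congrArg (fun v : Bits n → ℕ => ∑ z, v z) (sub_single_add_single hx)
    simp only [Pi.add_apply, Finset.sum_add_distrib, Finset.sum_pi_single', Finset.mem_univ,
      if_true] at h2
    simp only [Pi.sub_apply] at h2 ⊢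
    omega

/-- Unfolding of `momKet` with the commutation proof in the form that the lemmas about
noncommutative products expect. -/
theorem momKet_eq (u : Bits n → ℕ)
    (hc : ((Finset.univ : Finset (Bits n)) : Set (Bits n)).Pairwise
      (Function.onFun Commute fun z => creMom z ^ u z)) :
    momKet u = (((√((∏ x, (u x).factorial : ℕ) : ℝ))⁻¹ : ℝ) : ℂ) •
      (Finset.univ.noncommProd (fun z => creMom z ^ u z) hc) (vac n) := rfl

theorem creMom_pow_pairwise (u : Bits n → ℕ) (s : Finset (Bits n)) :
    (s : Set (Bits n)).Pairwise (Function.onFun Commute fun z => creMom z ^ u z) :=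
  fun x _ y _ _ => (creMom_commute x y).pow_pow (u x) (u y)

theorem momKet_zero : momKet (0 : Bits n → ℕ) = vac n := by
  rw [momKet_eq 0 (creMom_pow_pairwise _ _), Finset.noncommProd_eq_pow_card _ _ _ 1
    (fun z _ => by rw [Pi.zero_apply, pow_zero]), one_pow]
  simp

theorem creMom_momKet (x : Bits n) (u : Bits n → ℕ) :
    creMom x (momKet u) = ((√((u x : ℝ) + 1) : ℝ) : ℂ) • momKet (u + Pi.single x 1) := by
  -- generalized to products over any set of modes, for induction
  have hprod : ∀ (s : Finset (Bits n)) (hc hc'),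
      s.noncommProd (fun z => creMom z ^ (u + Pi.single x 1 : Bits n → ℕ) z) hc
        = (if x ∈ s then creMom x else 1) * s.noncommProd (fun z => creMom z ^ u z) hc' := by
    intro s
    induction s using Finset.induction_on with
    | empty => intro hc hc'; rw [Finset.noncommProd_empty, Finset.noncommProd_empty]; simp
    | insert a s ha ih =>
      intro hc hc'
      rw [Finset.noncommProd_insert_of_notMem _ _ _ _ ha,
        Finset.noncommProd_insert_of_notMem _ _ _ _ ha,
        ih _ (hc'.mono (Finset.coe_subset.2 (Finset.subset_insert a s)))]
      · rcases eq_or_ne x a with rfl | hxa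
        · rw [if_neg ha, if_pos (Finset.mem_insert_self _ _), one_mul, Pi.add_apply,
            Pi.single_eq_same, pow_succ', mul_assoc]
        · have h1 : (x ∈ insert a s) = (x ∈ s) := by simp [hxa]
          simp only [h1, Pi.add_apply, Pi.single_eq_of_ne hxa.symm, add_zero]
          split_ifs
          · rw [← mul_assoc, ← mul_assoc, ((creMom_commute x a).pow_right (u a)).eq]
          · rw [one_mul, one_mul]
  have hfac : ((∏ z, ((u + Pi.single x 1 : Bits n → ℕ) z).factorial : ℕ) : ℝ)
      = ((u x : ℝ) + 1) * (∏ z, (u z).factorial : ℕ) := by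
    rw [← Finset.mul_prod_erase _ _ (Finset.mem_univ x),
      ← Finset.mul_prod_erase Finset.univ (fun z => (u z).factorial) (Finset.mem_univ x)]
    have : ∀ z ∈ Finset.univ.erase x, ((u + Pi.single x 1 : Bits n → ℕ) z).factorial = (u z).factorial :=
      fun z hz => by simp [(Finset.mem_erase.1 hz).1]
    rw [Finset.prod_congr rfl this]
    simp only [Pi.add_apply, Pi.single_eq_same, Nat.factorial_succ]
    push_cast; ring
  rw [momKet_eq u (creMom_pow_pairwise _ _), momKet_eq _ (creMom_pow_pairwise _ _), map_smul,
    hprod _ _ (creMom_pow_pairwise _ _), if_pos (Finset.mem_univ x), Module.End.mul_apply, smul_smul,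
    ← Complex.ofReal_mul, hfac, Real.sqrt_mul (by positivity), mul_inv, ← mul_assoc,
    mul_inv_cancel₀ (Real.sqrt_ne_zero'.2 (by positivity)), one_mul]

theorem momKet_add_single (x : Bits n) (u : Bits n → ℕ) :
    momKet (u + Pi.single x 1) = (((√((u x : ℝ) + 1))⁻¹ : ℝ) : ℂ) • creMom x (momKet u) := by
  rw [creMom_momKet, smul_smul, ← Complex.ofReal_mul,
    inv_mul_cancel₀ (Real.sqrt_ne_zero'.2 (by positivity)), Complex.ofReal_one, one_smul]

theorem annMom_vac (x : Bits n) : annMom x (vac n) = 0 := by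
  simp [annMom, vac, annPos_ket]

theorem annMom_momKet (x : Bits n) (u : Bits n → ℕ) :
    annMom x (momKet u) = ((√(u x : ℝ) : ℝ) : ℂ) • momKet (u - Pi.single x 1) := by
  induction u using occupation_induction with
  | h0 => simp [momKet_zero, annMom_vac]
  | hs u z ih =>
    have hcomm : annMom x (creMom z (momKet u)) = creMom z (annMom x (momKet u))
        + (if x = z then (1 : Module.End ℂ (FockSpace n)) else 0) (momKet u) := by
      rw [← Module.End.mul_apply, annMom_mul_creMom, LinearMap.add_apply, Module.End.mul_apply]
    rw [momKet_add_single, map_smul, hcomm, ih, map_smul, creMom_momKet, smul_smul]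
    rcases eq_or_ne x z with rfl | h
    · rw [if_pos rfl, Module.End.one_apply, add_single_sub_single]
      have h1 : (((√(u x : ℝ) : ℝ) : ℂ) * ((√((((u - Pi.single x 1 : Bits n → ℕ) x : ℕ) : ℝ) + 1) : ℝ) : ℂ)) •
          momKet (u - Pi.single x 1 + Pi.single x 1) = (((u x : ℝ)) : ℂ) • momKet u := by
        by_cases h0 : u x = 0
        · simp [h0]
        · have h2 : (((u - Pi.single x 1 : Bits n → ℕ) x : ℕ) : ℝ) + 1 = u x := by
            simp only [Pi.sub_apply, Pi.single_eq_same]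
            exact_mod_cast Nat.succ_pred_eq_of_ne_zero h0
          rw [sub_single_add_single h0, h2, ← Complex.ofReal_mul,
            Real.mul_self_sqrt (Nat.cast_nonneg _)]
      have h3 : (((u x : ℝ)) : ℂ) • momKet u + momKet u = (((u x : ℝ) + 1 : ℝ) : ℂ) • momKet u := by
        rw [Complex.ofReal_add, add_smul, Complex.ofReal_one, one_smul]
      rw [h1, h3, smul_smul, ← Complex.ofReal_mul, inv_mul_eq_div, Real.div_sqrt, Pi.add_apply,
        Pi.single_eq_same, Nat.cast_add, Nat.cast_one]
    · have h1 : (u - Pi.single x 1 : Bits n → ℕ) z = u z := by simp [h.symm]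
      have h2 : (u + Pi.single z 1 : Bits n → ℕ) x = u x := by simp [h]
      have h3 : u + Pi.single z 1 - Pi.single x 1 = u - Pi.single x 1 + Pi.single z 1 := by
        funext w
        rcases eq_or_ne w x with rfl | hw
        · simp [h]
        · simp [hw]
      rw [if_neg h, LinearMap.zero_apply, add_zero, h1, h2, h3, smul_smul, ← Complex.ofReal_mul,
        ← Complex.ofReal_mul, mul_left_comm, inv_mul_cancel₀ (Real.sqrt_ne_zero'.2 (by positivity)),
        mul_one]

theorem pairing_momKet (u v : Bits n → ℕ) :
    pairing (momKet u) (momKet v) = if u = v then 1 else 0 := by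
  induction u using occupation_induction generalizing v with
  | h0 =>
    rw [momKet_zero]
    by_cases hv : v = 0
    · subst hv
      rw [momKet_zero, if_pos rfl, vac, pairing_ket_left, ket, Finsupp.single_eq_same]
    · obtain ⟨z, hz⟩ := Function.ne_iff.1 hv
      rw [if_neg (Ne.symm hv), ← sub_single_add_single hz, momKet_add_single, map_smul,
        pairing_comm, pairing_creMom, annMom_vac, map_zero, smul_zero]
  | hs u z ih =>
    rw [momKet_add_single, map_smul, LinearMap.smul_apply, pairing_creMom, annMom_momKet, map_smul,
      ih]
    by_cases h : u + Pi.single z 1 = v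
    · subst h
      rw [add_single_sub_single, if_pos rfl, if_pos rfl, smul_smul, ← Complex.ofReal_mul,
        Pi.add_apply, Pi.single_eq_same, Nat.cast_add, Nat.cast_one,
        inv_mul_cancel₀ (Real.sqrt_ne_zero'.2 (by positivity))]
      simp
    · rw [if_neg h]
      split_ifs with h2
      · have : v z = 0 := by
          by_contra h0
          exact h (by rw [h2, sub_single_add_single h0])
        simp [this]
      · simp

theorem creMom_apply (x : Bits n) (φ : FockSpace n) (w : Bits n → ℕ) :
    creMom x φ w = (((√((2 : ℝ) ^ n))⁻¹ : ℝ) : ℂ) *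
      ∑ z, sgn z x * (((√(w z : ℝ) : ℝ) : ℂ) * φ (w - Pi.single z 1)) := by
  simp [creMom, crePos_apply]

theorem sum_add_single (u : Bits n → ℕ) (x : Bits n) :
    ∑ z, (u + Pi.single x 1 : Bits n → ℕ) z = ∑ z, u z + 1 := by
  simp [Finset.sum_add_distrib, Finset.sum_pi_single']

/-- Creation raises the number of bosons by one. -/
theorem momKet_apply_of_sum_ne (u w : Bits n → ℕ) (h : ∑ x, w x ≠ ∑ x, u x) : momKet u w = 0 := by
  induction u using occupation_induction generalizing w with
  | h0 =>
    rw [momKet_zero, vac, ket, Finsupp.single_apply, if_neg]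
    rintro rfl; exact h rfl
  | hs u x ih =>
    rw [momKet_add_single, Finsupp.smul_apply, creMom_apply]
    refine smul_eq_zero_of_right _ (mul_eq_zero_of_right _ (Finset.sum_eq_zero fun z _ => ?_))
    by_cases hz : w z = 0
    · simp [hz]
    · rw [ih (w - Pi.single z 1), mul_zero, mul_zero]
      intro h2
      apply h
      rw [sum_add_single, ← h2, ← sum_add_single _ z, sub_single_add_single hz]

theorem star_sgn (x y : Bits n) : star (sgn x y) = sgn x y := by simp [sgn]

theorem star_ofReal (a : ℝ) : star (a : ℂ) = a := Complex.conj_ofReal a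

theorem star_momKet_apply (u w : Bits n → ℕ) : star (momKet u w) = momKet u w := by
  induction u using occupation_induction generalizing w with
  | h0 =>
    rw [momKet_zero, vac, ket, Finsupp.single_apply]
    split_ifs <;> simp
  | hs u x ih =>
    rw [momKet_add_single, Finsupp.smul_apply, creMom_apply]
    simp only [smul_eq_mul, star_mul', star_sum, star_sgn, star_ofReal, ih]

/-! ### The hopping operators in the two Fock bases -/

/-- The hopping operator is diagonal in the position basis: the convolution over momenta becomes a
character over positions. -/
theorem hopEnd_apply (ℓ : ℕ) (y : Bits n) (φ : FockSpace n) (w : Bits n → ℕ) :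
    hopEnd ℓ y φ w = (((√(ℓ : ℝ))⁻¹ : ℝ) : ℂ) * (∑ x, (w x : ℂ) * sgn y x) * φ w := by
  have key : ∑ x, creMom (x + y) * annMom x
      = ∑ z, sgn y z • (crePos z * annPos z : Module.End ℂ (FockSpace n)) := by
    have h : ∀ c : ℂ, c * c * (2 : ℂ) ^ n = 1 →
        ∑ x, (c • ∑ t, sgn t (x + y) • crePos t) * (c • ∑ s, sgn s x • annPos s)
        = ∑ z, sgn y z • (crePos z * annPos z : Module.End ℂ (FockSpace n)) := fun c hc => by
      simp only [smul_mul_smul_comm, Finset.sum_mul_sum, Finset.smul_sum]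
      rw [Finset.sum_comm]
      refine Finset.sum_congr rfl fun t _ => ?_
      rw [Finset.sum_comm]
      have h1 : ∀ s, ∑ x, (c * c) • ((sgn t (x + y) * sgn s x) • (crePos t * annPos s))
          = ((c * c) * sgn t y * (if t = s then (2 : ℂ) ^ n else 0)) •
            (crePos t * annPos s : Module.End ℂ (FockSpace n)) := fun s => by
        rw [← sum_sgn_mul_sgn, Finset.mul_sum, Finset.sum_smul]
        refine Finset.sum_congr rfl fun x _ => ?_
        rw [smul_smul, sgn_add_right, sgn_comm x t, sgn_comm x s]
        congr 1; ring
      simp only [h1]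
      rw [Finset.sum_eq_single t (fun s _ hs => by rw [if_neg hs.symm, mul_zero, zero_smul])
        (by simp), if_pos rfl, sgn_comm y t]
      congr 1
      rw [mul_right_comm, hc, one_mul]
    exact h _ (mode_norm_sq n)
  rw [hopEnd, key, LinearMap.smul_apply, Finsupp.smul_apply, LinearMap.sum_apply,
    Finsupp.finsetSum_apply, smul_eq_mul, mul_assoc, Finset.sum_mul]
  congr 1
  refine Finset.sum_congr rfl fun x _ => ?_
  rw [LinearMap.smul_apply, Finsupp.smul_apply, Module.End.mul_apply, crePos_annPos_apply,
    smul_eq_mul]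
  ring

theorem hopEnd_momKet (ℓ : ℕ) (y : Bits n) (u : Bits n → ℕ) :
    hopEnd ℓ y (momKet u) = ∑ x, (((√(ℓ : ℝ))⁻¹ * (√(u x : ℝ) *
      √((((u - Pi.single x 1 : Bits n → ℕ) (x + y) : ℕ) : ℝ) + 1)) : ℝ) : ℂ) •
        momKet (u - Pi.single x 1 + Pi.single (x + y) 1) := by
  rw [hopEnd, LinearMap.smul_apply, LinearMap.sum_apply, Finset.smul_sum]
  refine Finset.sum_congr rfl fun x _ => ?_
  rw [Module.End.mul_apply, annMom_momKet, map_smul, creMom_momKet, smul_smul, smul_smul,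
    Complex.ofReal_mul, Complex.ofReal_mul, mul_assoc]

end

section
open scoped Matrix.Norms.L2Operator

variable {n : ℕ}

/-! ### Condensates and hopping as matrices -/

theorem norm_le_one_of_mem_unitaryGroup {ι : Type*} [Fintype ι] [DecidableEq ι]
    {U : Matrix ι ι ℂ} (hU : U ∈ Matrix.unitaryGroup ι ℂ) : ‖U‖ ≤ 1 := by
  cases isEmpty_or_nonempty ι
  · rw [Subsingleton.elim U 0, norm_zero]; exact zero_le_one
  · exact (CStarRing.norm_of_mem_unitary hU).le

/-- Schur's test: a matrix whose absolute row and column sums are at most `c` has operator norm at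
most `c`. -/
theorem norm_le_of_row_col_sum_le {ι : Type*} [Fintype ι] [DecidableEq ι] {N : Matrix ι ι ℂ}
    {c : ℝ} (hc : 0 ≤ c) (hrow : ∀ i, ∑ j, ‖N i j‖ ≤ c) (hcol : ∀ j, ∑ i, ‖N i j‖ ≤ c) :
    ‖N‖ ≤ c := by
  rw [Matrix.l2_opNorm_def]
  refine ContinuousLinearMap.opNorm_le_bound _ hc fun x => ?_
  refine abs_le_of_sq_le_sq' ?_ (by positivity) |>.2
  rw [mul_pow, EuclideanSpace.norm_sq_eq, EuclideanSpace.norm_sq_eq]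
  have hi : ∀ i, ‖(N *ᵥ x.ofLp) i‖ ^ 2 ≤ c * ∑ j, ‖N i j‖ * ‖x j‖ ^ 2 := fun i => by
    have h1 : ‖(N *ᵥ x.ofLp) i‖ ≤ ∑ j, ‖N i j‖ * ‖x j‖ :=
      (norm_sum_le _ _).trans (Finset.sum_le_sum fun j _ => (norm_mul _ _).le)
    have h2 : (∑ j, ‖N i j‖ * ‖x j‖) ^ 2 ≤ (∑ j, ‖N i j‖) * ∑ j, ‖N i j‖ * ‖x j‖ ^ 2 :=
      Finset.sum_sq_le_sum_mul_sum_of_sq_le_mul _ (fun j _ => norm_nonneg _)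
        (fun j _ => by positivity) fun j _ => le_of_eq (by ring)
    refine (pow_le_pow_left₀ (norm_nonneg _) h1 2).trans (h2.trans ?_)
    exact mul_le_mul_of_nonneg_right (hrow i) (Finset.sum_nonneg fun j _ => by positivity)
  calc _ ≤ ∑ i, c * ∑ j, ‖N i j‖ * ‖x j‖ ^ 2 := Finset.sum_le_sum fun i _ => hi i
    _ = c * ∑ j, (∑ i, ‖N i j‖) * ‖x j‖ ^ 2 := by
      rw [← Finset.mul_sum, Finset.sum_comm]
      simp only [Finset.sum_mul]
    _ ≤ c * ∑ j, c * ‖x j‖ ^ 2 := by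
      gcongr with j _
      exact hcol j
    _ = _ := by rw [← Finset.mul_sum]; ring

/-- The matrix whose columns are the momentum Fock states. -/
def momMat (n ℓ : ℕ) : Matrix (Occ n ℓ) (Occ n ℓ) ℂ := Matrix.of fun w u => momKet u.1 w.1

theorem sum_occ_eq_pairing (ℓ : ℕ) (u v : Occ n ℓ) :
    ∑ w : Occ n ℓ, momKet u.1 w.1 * momKet v.1 w.1 = pairing (momKet u.1) (momKet v.1) := by
  rw [pairing_eq_sum (Finset.univ.piAntidiag ℓ)]
  · exact (Finset.sum_subtype (Finset.univ.piAntidiag ℓ) (by simp)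
      fun w => momKet u.1 w * momKet v.1 w).symm
  · intro w hw
    refine momKet_apply_of_sum_ne _ _ fun h => hw ?_
    rw [u.2] at h
    simp [h]

theorem momMat_mem_unitaryGroup (n ℓ : ℕ) : momMat n ℓ ∈ Matrix.unitaryGroup (Occ n ℓ) ℂ := by
  rw [Matrix.mem_unitaryGroup_iff']
  ext u v
  rw [Matrix.star_eq_conjTranspose, Matrix.mul_apply]
  simp only [Matrix.conjTranspose_apply, momMat, Matrix.of_apply, star_momKet_apply,
    sum_occ_eq_pairing, pairing_momKet, Matrix.one_apply, Subtype.ext_iff]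

theorem momMat_star_mul (n ℓ : ℕ) : (momMat n ℓ)ᴴ * momMat n ℓ = 1 :=
  Matrix.mem_unitaryGroup_iff'.1 (momMat_mem_unitaryGroup n ℓ)

theorem momMat_mul_star (n ℓ : ℕ) : momMat n ℓ * (momMat n ℓ)ᴴ = 1 :=
  Matrix.mem_unitaryGroup_iff.1 (momMat_mem_unitaryGroup n ℓ)

theorem Con_eq (n ℓ r : ℕ) : Con n ℓ r = momMat n ℓ *
    Matrix.diagonal (fun u : Occ n ℓ => if ℓ ≤ u.1 0 + r then (1 : ℂ) else 0) * (momMat n ℓ)ᴴ := by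
  ext v w
  rw [Con, Matrix.sum_apply, Matrix.mul_apply, Finset.sum_filter]
  refine Finset.sum_congr rfl fun u _ => ?_
  rw [Matrix.mul_diagonal]
  split_ifs
  · simp [Matrix.vecMulVec_apply, coords, momMat, Matrix.conjTranspose_apply]
  · simp

theorem momMat_conj_mul {ℓ : ℕ} (X Y : Matrix (Occ n ℓ) (Occ n ℓ) ℂ) :
    momMat n ℓ * X * (momMat n ℓ)ᴴ * (momMat n ℓ * Y * (momMat n ℓ)ᴴ)
      = momMat n ℓ * (X * Y) * (momMat n ℓ)ᴴ := by
  calc _ = momMat n ℓ * X * ((momMat n ℓ)ᴴ * momMat n ℓ) * Y * (momMat n ℓ)ᴴ := by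
        simp only [mul_assoc]
    _ = _ := by rw [momMat_star_mul, mul_one, mul_assoc (momMat n ℓ) X Y]

theorem Con_mul_Con (ℓ : ℕ) {r s : ℕ} (h : r ≤ s) : Con n ℓ s * Con n ℓ r = Con n ℓ r := by
  rw [Con_eq, Con_eq, momMat_conj_mul, Matrix.diagonal_mul_diagonal]
  congr 3
  funext u
  split_ifs with h1 h2
  · simp
  · simp
  · omega
  · simp

theorem Con_isHermitian (n ℓ r : ℕ) : (Con n ℓ r).IsHermitian := by
  rw [Con_eq]
  refine Matrix.isHermitian_mul_mul_conjTranspose _ (Matrix.isHermitian_diagonal_of_self_adjoint _ ?_)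
  rw [isSelfAdjoint_iff]
  funext u
  rw [Pi.star_apply]
  split_ifs <;> simp

theorem Con_eq_one {ℓ r : ℕ} (h : ℓ ≤ r) : Con n ℓ r = 1 := by
  have : (fun u : Occ n ℓ => if ℓ ≤ u.1 0 + r then (1 : ℂ) else 0) = fun _ => 1 := by
    funext u; rw [if_pos (by omega)]
  rw [Con_eq, this, Matrix.diagonal_one, mul_one, momMat_mul_star]

/-- Eigenvalues of the hopping operator in the position Fock basis. -/
def hopEig {ℓ : ℕ} (y : Bits n) (u : Occ n ℓ) : ℝ :=
  (√(ℓ : ℝ))⁻¹ * ∑ x, (u.1 x : ℝ) * (-1) ^ (y ⬝ᵥ x).val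

theorem hopEnd_apply_occ (ℓ : ℕ) (y : Bits n) (φ : FockSpace n) (u : Occ n ℓ) :
    hopEnd ℓ y φ u.1 = (hopEig y u : ℂ) * φ u.1 := by
  rw [hopEnd_apply, hopEig]
  push_cast
  rfl

theorem hop_eq_diagonal (ℓ : ℕ) (y : Bits n) :
    hop ℓ y = Matrix.diagonal fun u : Occ n ℓ => (hopEig y u : ℂ) := by
  ext u v
  rw [hop, Matrix.of_apply, coords, hopEnd_apply_occ, Matrix.diagonal_apply, ket,
    Finsupp.single_apply]
  by_cases h : u = v
  · subst h; simp
  · rw [if_neg h, if_neg (fun h' => h (Subtype.ext h'.symm)), mul_zero]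

theorem hop_isHermitian (ℓ : ℕ) (y : Bits n) : (hop ℓ y).IsHermitian := by
  rw [hop_eq_diagonal]
  refine Matrix.isHermitian_diagonal_of_self_adjoint _ ?_
  rw [isSelfAdjoint_iff]
  funext u
  exact Complex.conj_ofReal _

theorem hop_sq_eq_diagonal (ℓ : ℕ) (y : Bits n) :
    hop ℓ y ^ 2 = Matrix.diagonal fun u : Occ n ℓ => ((gam y u : ℝ) : ℂ) := by
  rw [hop_eq_diagonal, Matrix.diagonal_pow]
  congr 1
  funext u
  simp [gam, hopEig]

theorem hop_zero (ℓ : ℕ) : hop ℓ (0 : Bits n) = ((√(ℓ : ℝ) : ℝ) : ℂ) • 1 := by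
  rw [hop_eq_diagonal, Matrix.smul_one_eq_diagonal]
  congr 1
  funext u
  have h : hopEig (0 : Bits n) u = (√(ℓ : ℝ))⁻¹ * ℓ := by
    rw [hopEig]
    simp only [zero_dotProduct, ZMod.val_zero, pow_zero, mul_one]
    rw [← Nat.cast_sum, u.2]
  rw [h, inv_mul_eq_div, Real.div_sqrt]

/-- Hopping amplitude out of the occupation `u`, for a boson moving from momentum `x` to `x + y`. -/
def hopAmp (ℓ : ℕ) (y : Bits n) (u : Bits n → ℕ) (x : Bits n) : ℝ :=
  (√(ℓ : ℝ))⁻¹ * (√(u x : ℝ) * √((((u - Pi.single x 1 : Bits n → ℕ) (x + y) : ℕ) : ℝ) + 1))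

theorem hopAmp_nonneg (ℓ : ℕ) (y : Bits n) (u : Bits n → ℕ) (x : Bits n) :
    0 ≤ hopAmp ℓ y u x := by unfold hopAmp; positivity

/-- The hopping operator in the momentum Fock basis. -/
def hopMom (ℓ : ℕ) (y : Bits n) : Matrix (Occ n ℓ) (Occ n ℓ) ℂ :=
  (momMat n ℓ)ᴴ * hop ℓ y * momMat n ℓ

theorem hopMom_isHermitian (ℓ : ℕ) (y : Bits n) : (hopMom ℓ y).IsHermitian :=
  Matrix.isHermitian_conjTranspose_mul_mul _ (hop_isHermitian ℓ y)

theorem hop_eq_conj_hopMom (ℓ : ℕ) (y : Bits n) :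
    hop ℓ y = momMat n ℓ * hopMom ℓ y * (momMat n ℓ)ᴴ := by
  calc hop ℓ y = (momMat n ℓ * (momMat n ℓ)ᴴ) * hop ℓ y * (momMat n ℓ * (momMat n ℓ)ᴴ) := by
        rw [momMat_mul_star, one_mul, mul_one]
    _ = _ := by rw [hopMom]; simp only [mul_assoc]

theorem hopMom_apply (ℓ : ℕ) (y : Bits n) (v u : Occ n ℓ) :
    hopMom ℓ y v u = ((∑ x, if v.1 = u.1 - Pi.single x 1 + Pi.single (x + y) 1
      then hopAmp ℓ y u.1 x else 0 : ℝ) : ℂ) := by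
  have h1 : hopMom ℓ y v u = pairing (momKet v.1) (hopEnd ℓ y (momKet u.1)) := by
    rw [hopMom, mul_assoc, Matrix.mul_apply, pairing_eq_sum (Finset.univ.piAntidiag ℓ)]
    · rw [Finset.sum_subtype (p := fun w : Bits n → ℕ => ∑ x, w x = ℓ)
        (Finset.univ.piAntidiag ℓ) (by simp)]
      refine Finset.sum_congr rfl fun w _ => ?_
      rw [hop_eq_diagonal, Matrix.diagonal_mul, Matrix.conjTranspose_apply, hopEnd_apply_occ ℓ y _ w]
      simp only [momMat, Matrix.of_apply, star_momKet_apply]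
    · intro w hw
      refine momKet_apply_of_sum_ne _ _ fun h => hw ?_
      rw [v.2] at h
      simp [h]
  rw [h1, hopEnd_momKet, map_sum, Complex.ofReal_sum]
  refine Finset.sum_congr rfl fun x _ => ?_
  rw [map_smul, pairing_momKet, hopAmp]
  split_ifs <;> simp

theorem sum_norm_hopMom_le (ℓ : ℕ) (y : Bits n) (u : Occ n ℓ) :
    ∑ v, ‖hopMom ℓ y v u‖ ≤ ∑ x, hopAmp ℓ y u.1 x := by
  have h : ∀ v, ‖hopMom ℓ y v u‖ = ∑ x, if v.1 = u.1 - Pi.single x 1 + Pi.single (x + y) 1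
      then hopAmp ℓ y u.1 x else 0 := fun v => by
    rw [hopMom_apply, Complex.norm_real, Real.norm_of_nonneg]
    refine Finset.sum_nonneg fun x _ => ?_
    split_ifs
    · exact hopAmp_nonneg _ _ _ _
    · exact le_rfl
  simp only [h]
  rw [Finset.sum_comm]
  refine Finset.sum_le_sum fun x _ => ?_
  rw [← Finset.sum_filter, Finset.sum_const, nsmul_eq_mul]
  refine mul_le_of_le_one_left (hopAmp_nonneg _ _ _ _) ?_
  refine Nat.cast_le_one.2 (Finset.card_le_one.2 fun a ha b hb => Subtype.ext ?_)
  rw [(Finset.mem_filter.1 ha).2, (Finset.mem_filter.1 hb).2]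

theorem sqrt_mul_sqrt_succ_le (a b : ℕ) : √(a : ℝ) * √((b : ℝ) + 1) ≤ a + b := by
  rcases Nat.eq_zero_or_pos a with rfl | ha
  · simp
  · rw [← Real.sqrt_mul (Nat.cast_nonneg _), Real.sqrt_le_left (by positivity)]
    have : (1 : ℝ) ≤ a := by exact_mod_cast ha
    have hb : (0 : ℝ) ≤ b := Nat.cast_nonneg b
    nlinarith

/-- Out of a `k`-condensate the total hopping amplitude is `O(√k)`, uniformly in the number of
bosons: each of the two moves touching the condensate is enhanced by at most `√ℓ`, and the moves among
excited bosons have total weight at most twice the number of those. -/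
theorem sum_hopAmp_le {ℓ k : ℕ} {y : Bits n} (hy : y ≠ 0) (u : Occ n ℓ) (hu : ℓ ≤ u.1 0 + k) :
    ∑ x, hopAmp ℓ y u.1 x ≤ 4 * √((k : ℝ) + 1) := by
  have hsub : ∀ x, (u.1 - Pi.single x 1 : Bits n → ℕ) (x + y) = u.1 (x + y) := fun x => by
    have : x + y ≠ x := by simpa using hy
    simp [this]
  simp only [hopAmp, hsub]
  rw [← Finset.mul_sum]
  set e : ℕ := ∑ x ∈ Finset.univ.erase 0, u.1 x with he
  have htot : u.1 0 + e = ℓ := by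
    rw [he, Finset.add_sum_erase _ _ (Finset.mem_univ _), u.2]
  have hek : e ≤ k := by omega
  have hle : ∀ x, x ≠ 0 → u.1 x ≤ e := fun x hx =>
    Finset.single_le_sum (f := u.1) (fun _ _ => Nat.zero_le _)
      (Finset.mem_erase.2 ⟨hx, Finset.mem_univ x⟩)
  have hk : √(e : ℝ) ≤ √((k : ℝ) + 1) := Real.sqrt_le_sqrt (by
    have : (e : ℝ) ≤ k := by exact_mod_cast hek
    linarith)
  have hsplit : ∀ f : Bits n → ℝ, ∑ x, f x = f 0 + (f y + ∑ x ∈ (Finset.univ.erase 0).erase y, f x) :=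
    fun f => by
      rw [Finset.add_sum_erase _ _ (Finset.mem_erase.2 ⟨hy, Finset.mem_univ y⟩),
        Finset.add_sum_erase _ _ (Finset.mem_univ _)]
  have t1 : √(u.1 0 : ℝ) * √((u.1 (0 + y) : ℝ) + 1) ≤ √(ℓ : ℝ) * √((k : ℝ) + 1) := by
    rw [zero_add]
    refine mul_le_mul (Real.sqrt_le_sqrt ?_) (Real.sqrt_le_sqrt ?_) (by positivity) (by positivity)
    · exact_mod_cast (by omega : u.1 0 ≤ ℓ)
    · have : u.1 y ≤ k := (hle y hy).trans hek
      gcongr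
  have t2 : √(u.1 y : ℝ) * √((u.1 (y + y) : ℝ) + 1) ≤ √(ℓ : ℝ) * √((k : ℝ) + 1) := by
    rw [bits_add_self]
    rcases Nat.eq_zero_or_pos (u.1 y) with h0 | h0
    · rw [h0]; simp only [Nat.cast_zero, Real.sqrt_zero, zero_mul]; positivity
    · have h1 := hle y hy
      rw [mul_comm]
      refine mul_le_mul (Real.sqrt_le_sqrt ?_) (Real.sqrt_le_sqrt ?_) (by positivity) (by positivity)
      · exact_mod_cast (by omega : u.1 0 + 1 ≤ ℓ)
      · have : u.1 y ≤ k := h1.trans hek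
        have : (u.1 y : ℝ) ≤ k := by exact_mod_cast this
        linarith
  have t3 : ∑ x ∈ (Finset.univ.erase 0).erase y, √(u.1 x : ℝ) * √((u.1 (x + y) : ℝ) + 1)
      ≤ 2 * (√(ℓ : ℝ) * √((k : ℝ) + 1)) := by
    refine (Finset.sum_le_sum fun x _ => sqrt_mul_sqrt_succ_le (u.1 x) (u.1 (x + y))).trans ?_
    rw [Finset.sum_add_distrib, two_mul]
    have hee : (e : ℝ) ≤ √(ℓ : ℝ) * √((k : ℝ) + 1) := by
      calc (e : ℝ) = √(e : ℝ) * √(e : ℝ) := (Real.mul_self_sqrt (Nat.cast_nonneg _)).symm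
        _ ≤ _ := mul_le_mul (Real.sqrt_le_sqrt (by exact_mod_cast (by omega : e ≤ ℓ))) hk
          (by positivity) (by positivity)
    refine add_le_add (le_trans ?_ hee) (le_trans ?_ hee)
    · rw [he, Nat.cast_sum]
      exact Finset.sum_le_sum_of_subset_of_nonneg (Finset.erase_subset _ _) fun _ _ _ => by positivity
    · have h2 : ∑ x ∈ (Finset.univ.erase 0).erase y, (u.1 (x + y) : ℝ)
          = ∑ z ∈ ((Finset.univ.erase 0).erase y).map (Equiv.addRight y).toEmbedding, (u.1 z : ℝ) := by
        rw [Finset.sum_map]; rfl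
      rw [h2, he, Nat.cast_sum]
      refine Finset.sum_le_sum_of_subset_of_nonneg (fun z hz => ?_) fun _ _ _ => by positivity
      obtain ⟨x, hx, rfl⟩ := Finset.mem_map.1 hz
      refine Finset.mem_erase.2 ⟨fun h0 => ?_, Finset.mem_univ _⟩
      exact (Finset.mem_erase.1 hx).1 (bits_add_eq_zero.1 h0)
  rcases Nat.eq_zero_or_pos ℓ with h0 | h0
  · have hz : (√(ℓ : ℝ))⁻¹ = 0 := by rw [h0, Nat.cast_zero, Real.sqrt_zero, inv_zero]
    rw [hz, zero_mul]; positivity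
  · rw [inv_mul_le_iff₀ (Real.sqrt_pos.2 (by exact_mod_cast h0)),
      hsplit fun x => √(u.1 x : ℝ) * √((u.1 (x + y) : ℝ) + 1)]
    linarith

theorem hopMom_ne_zero {ℓ : ℕ} {y : Bits n} {v u : Occ n ℓ} (h : hopMom ℓ y v u ≠ 0) :
    u.1 0 ≤ v.1 0 + 1 := by
  rw [hopMom_apply, Complex.ofReal_ne_zero] at h
  obtain ⟨x, -, hx⟩ := Finset.exists_ne_zero_of_sum_ne_zero h
  have hv := (ite_ne_right_iff.1 hx).1
  have h1 : (Pi.single x 1 : Bits n → ℕ) 0 ≤ 1 := by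
    rw [Pi.single_apply]; split_ifs <;> omega
  have h2 : v.1 0 = u.1 0 - (Pi.single x 1 : Bits n → ℕ) 0 + (Pi.single (x + y) 1 : Bits n → ℕ) 0 :=
    congrFun hv 0
  omega

/-- One hop excites at most one boson. -/
theorem Con_succ_mul_hop_mul_Con (ℓ k : ℕ) (y : Bits n) :
    Con n ℓ (k + 1) * hop ℓ y * Con n ℓ k = hop ℓ y * Con n ℓ k := by
  rw [hop_eq_conj_hopMom, Con_eq, Con_eq, momMat_conj_mul, momMat_conj_mul, momMat_conj_mul]
  refine congrArg (fun X => momMat n ℓ * X * (momMat n ℓ)ᴴ) ?_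
  ext v u
  rw [Matrix.mul_diagonal, Matrix.mul_diagonal, Matrix.diagonal_mul]
  by_cases h : hopMom ℓ y v u = 0
  · simp [h]
  · have := hopMom_ne_zero h
    split_ifs with h1 h2
    · simp
    · simp
    · omega
    · simp

/-- Schur's test in the momentum Fock basis. The row sums reach one excitation further than the column
sums, hence the constant `32 > 4²`. -/
theorem norm_hop_mul_Con_le (ℓ k : ℕ) {y : Bits n} (hy : y ≠ 0) :
    ‖hop ℓ y * Con n ℓ k‖ ≤ √(32 * ((k : ℝ) + 1)) := by
  have hk0 : (0 : ℝ) ≤ k := Nat.cast_nonneg k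
  have hc : ∀ j : ℕ, j ≤ k + 1 → 4 * √((j : ℝ) + 1) ≤ √(32 * ((k : ℝ) + 1)) := fun j hj => by
    have hj' : (j : ℝ) ≤ k + 1 := by exact_mod_cast hj
    refine Real.le_sqrt_of_sq_le ?_
    rw [mul_pow, Real.sq_sqrt (by positivity)]
    linarith
  rw [hop_eq_conj_hopMom, Con_eq, momMat_conj_mul]
  have hU := norm_le_one_of_mem_unitaryGroup (momMat_mem_unitaryGroup n ℓ)
  have hU' : ‖(momMat n ℓ)ᴴ‖ ≤ 1 := by rwa [Matrix.l2_opNorm_conjTranspose]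
  set D : Matrix (Occ n ℓ) (Occ n ℓ) ℂ :=
    Matrix.diagonal (fun u : Occ n ℓ => if ℓ ≤ u.1 0 + k then (1 : ℂ) else 0) with hD
  have hent : ∀ v u, ‖(hopMom ℓ y * D) v u‖
      = if ℓ ≤ u.1 0 + k then ‖hopMom ℓ y v u‖ else 0 := fun v u => by
    rw [hD, Matrix.mul_diagonal]
    split_ifs <;> simp
  have hN : ‖hopMom ℓ y * D‖ ≤ √(32 * ((k : ℝ) + 1)) := by
    refine norm_le_of_row_col_sum_le (by positivity) (fun v => ?_) fun u => ?_
    · simp only [hent]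
      by_cases hv : ℓ ≤ v.1 0 + (k + 1)
      · refine le_trans (Finset.sum_le_sum fun u _ => ?_)
          ((sum_norm_hopMom_le ℓ y v).trans ((sum_hopAmp_le hy v hv).trans (hc (k + 1) le_rfl)))
        have hsymm : ‖hopMom ℓ y u v‖ = ‖hopMom ℓ y v u‖ := by
          rw [← (hopMom_isHermitian ℓ y).apply u v, norm_star]
        rw [hsymm]
        split_ifs
        · exact le_rfl
        · exact norm_nonneg _
      · rw [Finset.sum_eq_zero]
        · positivity
        · intro u _
          split_ifs with h1
          · by_contra h2
            have := hopMom_ne_zero (norm_ne_zero_iff.1 h2)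
            omega
          · rfl
    · simp only [hent]
      split_ifs with h1
      · exact (sum_norm_hopMom_le ℓ y u).trans ((sum_hopAmp_le hy u h1).trans (hc k (Nat.le_succ k)))
      · rw [Finset.sum_const_zero]; positivity
  calc _ ≤ ‖momMat n ℓ‖ * ‖hopMom ℓ y * D‖ * ‖(momMat n ℓ)ᴴ‖ :=
        (norm_mul_le _ _).trans (mul_le_mul_of_nonneg_right (norm_mul_le _ _) (norm_nonneg _))
    _ ≤ 1 * √(32 * ((k : ℝ) + 1)) * 1 := by gcongr
    _ = _ := by ring

/-- All bosons in the zero-momentum mode. -/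
def condOcc (n ℓ : ℕ) : Occ n ℓ := ⟨Pi.single 0 ℓ, by simp⟩

theorem initS_eq (n ℓ : ℕ) : initS n ℓ = coords ℓ (momKet (condOcc n ℓ).1) := by
  have h : ∀ k : ℕ, (creMom (0 : Bits n) ^ k) (vac n)
      = ((√(k.factorial : ℝ) : ℝ) : ℂ) • momKet (Pi.single 0 k : Bits n → ℕ) := by
    intro k
    induction k with
    | zero => simp [momKet_zero]
    | succ k ih =>
      rw [pow_succ', Module.End.mul_apply, ih, map_smul, creMom_momKet, smul_smul,
        ← Complex.ofReal_mul, ← Real.sqrt_mul (Nat.cast_nonneg _), Pi.single_eq_same,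
        ← Pi.single_add, Nat.factorial_succ]
      push_cast
      rw [mul_comm]
  rw [initS, h, smul_smul, ← Complex.ofReal_mul, inv_mul_cancel₀, Complex.ofReal_one, one_smul]
  · rfl
  · exact Real.sqrt_ne_zero'.2 (by exact_mod_cast Nat.factorial_pos ℓ)

theorem coords_momKet {ℓ : ℕ} (u : Occ n ℓ) :
    coords ℓ (momKet u.1) = momMat n ℓ *ᵥ Pi.single u 1 := by
  funext w
  simp [coords, momMat]

theorem Con_mulVec_initS (n ℓ r : ℕ) : Con n ℓ r *ᵥ initS n ℓ = initS n ℓ := by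
  rw [initS_eq, coords_momKet, Con_eq, Matrix.mulVec_mulVec, mul_assoc, momMat_star_mul, mul_one,
    ← Matrix.mulVec_mulVec, Matrix.diagonal_mulVec_single, if_pos (by simp [condOcc]), one_mul]

theorem norm_initS_le (n ℓ : ℕ) : ‖WithLp.toLp 2 (initS n ℓ)‖ ≤ 1 := by
  rw [initS_eq, coords_momKet]
  refine (Matrix.l2_opNorm_mulVec _ (WithLp.toLp 2 (Pi.single (condOcc n ℓ) 1 : Occ n ℓ → ℂ))).trans ?_
  have h1 : ‖WithLp.toLp 2 (Pi.single (condOcc n ℓ) 1 : Occ n ℓ → ℂ)‖ = 1 := by simp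
  rw [h1, mul_one]
  exact norm_le_one_of_mem_unitaryGroup (momMat_mem_unitaryGroup n ℓ)

end

section
open scoped Matrix.Norms.L2Operator ComplexOrder

variable {n : ℕ}

/-! ### Functional calculus of Hermitian matrices -/

theorem continuousOn_spectrum {ι : Type*} [Fintype ι] [DecidableEq ι] (f : ℝ → ℝ)
    (A : Matrix ι ι ℂ) : ContinuousOn f (spectrum ℝ A) :=
  Matrix.finite_real_spectrum.continuousOn f

theorem aeval_mul_of_mul_eq_smul {ι : Type*} [Fintype ι] [DecidableEq ι] {A P : Matrix ι ι ℂ} {c : ℝ}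
    (h : A * P = c • P) (p : Polynomial ℝ) : Polynomial.aeval A p * P = p.eval c • P := by
  have hpow : ∀ k : ℕ, A ^ k * P = c ^ k • P := fun k => by
    induction k with
    | zero => simp
    | succ k ih => rw [pow_succ, mul_assoc, h, mul_smul_comm, ih, smul_smul, pow_succ']
  induction p using Polynomial.induction_on' with
  | add p q hp hq => rw [map_add, add_mul, hp, hq, Polynomial.eval_add, add_smul]
  | monomial k a =>
    rw [Polynomial.aeval_monomial, Polynomial.eval_monomial, mul_assoc, hpow,
      Algebra.algebraMap_eq_smul_one, smul_mul_assoc, one_mul, smul_smul]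

/-- The functional calculus acts on eigenvectors (here the columns of `P`) by the scalar function. -/
theorem cfc_mul_of_mul_eq_smul {ι : Type*} [Fintype ι] [DecidableEq ι] {A P : Matrix ι ι ℂ} {c : ℝ}
    (hA : A.IsHermitian) (h : A * P = c • P) (f : ℝ → ℝ) : cfc f A * P = f c • P := by
  classical
  -- on a finite spectrum every function is a polynomial
  let s : Finset ℝ := insert c (Matrix.finite_real_spectrum (A := A)).toFinset
  let p : Polynomial ℝ := Lagrange.interpolate s id f
  have hp : ∀ z ∈ s, p.eval z = f z := fun z hz =>
    Lagrange.eval_interpolate_at_node f (Function.injective_id.injOn) hz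
  have h1 : cfc f A = Polynomial.aeval A p := by
    rw [← cfc_polynomial p A hA.isSelfAdjoint]
    exact cfc_congr fun z hz => (hp z (by simp [s, hz])).symm
  rw [h1, aeval_mul_of_mul_eq_smul h, hp c (by simp [s])]

theorem cfc_diagonal {ι : Type*} [Fintype ι] [DecidableEq ι] (d : ι → ℝ) (f : ℝ → ℝ) :
    cfc f (Matrix.diagonal fun i => (d i : ℂ)) = Matrix.diagonal fun i => ((f (d i) : ℝ) : ℂ) := by
  have hA : (Matrix.diagonal fun i => (d i : ℂ)).IsHermitian := by
    refine Matrix.isHermitian_diagonal_of_self_adjoint _ ?_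
    rw [isSelfAdjoint_iff]
    funext u
    exact Complex.conj_ofReal _
  ext i j
  have h : (Matrix.diagonal fun i => (d i : ℂ)) * Matrix.single j j 1
      = d j • Matrix.single j j (1 : ℂ) := by
    ext a b
    rw [Matrix.diagonal_mul, Matrix.smul_apply, Matrix.single_apply]
    split_ifs with hab
    · simp [hab.1]
    · simp
  have h1 := congrArg (fun M : Matrix ι ι ℂ => M i j) (cfc_mul_of_mul_eq_smul hA h f)
  simp only [Matrix.mul_single_apply_same, mul_one, Matrix.smul_apply] at h1
  rw [h1, Matrix.diagonal_apply, Matrix.single_apply]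
  by_cases hij : i = j
  · subst hij; simp
  · simp [hij, Ne.symm hij]

theorem abs_le_norm_of_mem_spectrum {ι : Type*} [Fintype ι] [DecidableEq ι] {A : Matrix ι ι ℂ}
    {z : ℝ} (h : z ∈ spectrum ℝ A) : |z| ≤ ‖A‖ := by
  cases isEmpty_or_nonempty ι
  · rw [spectrum.of_subsingleton] at h; exact h.elim
  · exact spectrum.norm_le_norm_of_mem h

theorem nonneg_of_mem_spectrum {ι : Type*} [Fintype ι] [DecidableEq ι] {A : Matrix ι ι ℂ}
    (hA : A.PosSemidef) {z : ℝ} (h : z ∈ spectrum ℝ A) : 0 ≤ z := by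
  rw [hA.1.spectrum_real_eq_range_eigenvalues] at h
  obtain ⟨i, rfl⟩ := h
  exact hA.eigenvalues_nonneg i

theorem norm_cfc_sub_aeval_le {ι : Type*} [Fintype ι] [DecidableEq ι] {A : Matrix ι ι ℂ}
    (hA : A.PosSemidef) {Λ err : ℝ} (hΛ : ‖A‖ ≤ Λ) (he : 0 ≤ err) {f : ℝ → ℝ} {p : Polynomial ℝ}
    (h : ∀ z ∈ Set.Icc 0 Λ, |f z - p.eval z| ≤ err) : ‖cfc f A - Polynomial.aeval A p‖ ≤ err := by
  rw [← cfc_polynomial p A hA.1.isSelfAdjoint,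
    ← cfc_sub f (fun x => p.eval x) A (continuousOn_spectrum _ _) (continuousOn_spectrum _ _)]
  exact norm_cfc_le he fun z hz => h z ⟨nonneg_of_mem_spectrum hA hz,
    (le_abs_self z).trans ((abs_le_norm_of_mem_spectrum hz).trans hΛ)⟩

/-! ### Truncating the squared hopping operator to condensates -/

/-- The squared hopping operator truncated to `R`-condensates. -/
def truncHop {n : ℕ} (ℓ R : ℕ) (y : Bits n) : Matrix (Occ n ℓ) (Occ n ℓ) ℂ :=
  Con n ℓ R * hop ℓ y ^ 2 * Con n ℓ R

theorem truncHop_eq (ℓ R : ℕ) (y : Bits n) :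
    truncHop ℓ R y = (hop ℓ y * Con n ℓ R)ᴴ * (hop ℓ y * Con n ℓ R) := by
  rw [truncHop, Matrix.conjTranspose_mul, (hop_isHermitian ℓ y).eq, (Con_isHermitian n ℓ R).eq, sq]
  simp only [mul_assoc]

theorem truncHop_posSemidef (ℓ R : ℕ) (y : Bits n) : (truncHop ℓ R y).PosSemidef := by
  rw [truncHop_eq]
  exact Matrix.posSemidef_conjTranspose_mul_self _

theorem truncHop_of_le {ℓ R : ℕ} (h : ℓ ≤ R) (y : Bits n) : truncHop ℓ R y = hop ℓ y ^ 2 := by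
  rw [truncHop, Con_eq_one h, one_mul, mul_one]

theorem norm_truncHop_le (ℓ R : ℕ) {y : Bits n} (hy : y ≠ 0) :
    ‖truncHop ℓ R y‖ ≤ 32 * ((R : ℝ) + 1) := by
  rw [truncHop_eq, Matrix.l2_opNorm_conjTranspose_mul_self]
  calc _ ≤ √(32 * ((R : ℝ) + 1)) * √(32 * ((R : ℝ) + 1)) := by
        gcongr <;> exact norm_hop_mul_Con_le ℓ R hy
    _ = _ := Real.mul_self_sqrt (by positivity)

theorem Con_mul_hop_sq_mul_Con (ℓ k : ℕ) (y : Bits n) :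
    Con n ℓ (k + 2) * (hop ℓ y ^ 2 * Con n ℓ k) = hop ℓ y ^ 2 * Con n ℓ k := by
  have h1 : hop ℓ y ^ 2 * Con n ℓ k = hop ℓ y * Con n ℓ (k + 1) * (hop ℓ y * Con n ℓ k) := by
    conv_lhs => rw [sq, mul_assoc, ← Con_succ_mul_hop_mul_Con]
    simp only [mul_assoc]
  rw [h1, ← Con_succ_mul_hop_mul_Con ℓ (k + 1)]
  simp only [← mul_assoc]
  rw [Con_mul_Con ℓ le_rfl]

theorem Con_mul_hop_sq_pow_mul_Con (ℓ r k : ℕ) (y : Bits n) :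
    Con n ℓ (r + 2 * k) * ((hop ℓ y ^ 2) ^ k * Con n ℓ r) = (hop ℓ y ^ 2) ^ k * Con n ℓ r := by
  induction k with
  | zero => simp [Con_mul_Con ℓ (le_refl r)]
  | succ k ih =>
    have h1 : (hop ℓ y ^ 2) ^ (k + 1) * Con n ℓ r
        = hop ℓ y ^ 2 * Con n ℓ (r + 2 * k) * ((hop ℓ y ^ 2) ^ k * Con n ℓ r) := by
      rw [mul_assoc, ih, pow_succ', mul_assoc]
    rw [h1, ← mul_assoc, show r + 2 * (k + 1) = r + 2 * k + 2 by ring,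
      Con_mul_hop_sq_mul_Con]

/-- Few applications of the squared hopping operator to an `r`-condensate do not notice the
truncation. -/
theorem truncHop_pow_mul_Con {ℓ r k R : ℕ} (h : r + 2 * k ≤ R) (y : Bits n) :
    truncHop ℓ R y ^ k * Con n ℓ r = (hop ℓ y ^ 2) ^ k * Con n ℓ r := by
  induction k with
  | zero => simp
  | succ k ih =>
    have h1 := Con_mul_hop_sq_pow_mul_Con ℓ r k y
    have h2 := Con_mul_hop_sq_pow_mul_Con ℓ r (k + 1) y
    rw [pow_succ', mul_assoc, ih (by omega), truncHop]
    rw [← h1, mul_assoc, ← mul_assoc (Con n ℓ R) (Con n ℓ (r + 2 * k)),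
      Con_mul_Con ℓ (by omega : r + 2 * k ≤ R), h1, mul_assoc, ← mul_assoc (hop ℓ y ^ 2), ← pow_succ',
      ← h2, ← mul_assoc, Con_mul_Con ℓ h]

theorem aeval_truncHop_mul_Con {ℓ r R R' : ℕ} {p : Polynomial ℝ} (h : r + 2 * p.natDegree ≤ R)
    (h' : R ≤ R') (y : Bits n) :
    Polynomial.aeval (truncHop ℓ R y) p * Con n ℓ r
      = Polynomial.aeval (truncHop ℓ R' y) p * Con n ℓ r := by
  rw [Polynomial.aeval_eq_sum_range, Polynomial.aeval_eq_sum_range, Finset.sum_mul, Finset.sum_mul]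
  refine Finset.sum_congr rfl fun k hk => ?_
  have hk' : k ≤ p.natDegree := Nat.lt_succ_iff.1 (Finset.mem_range.1 hk)
  rw [smul_mul_assoc, smul_mul_assoc, truncHop_pow_mul_Con (by omega),
    truncHop_pow_mul_Con (by omega)]

theorem norm_Con_le (n ℓ r : ℕ) : ‖Con n ℓ r‖ ≤ 1 := by
  have h := Matrix.l2_opNorm_conjTranspose_mul_self (Con n ℓ r)
  rw [(Con_isHermitian n ℓ r).eq, Con_mul_Con ℓ le_rfl] at h
  nlinarith [norm_nonneg (Con n ℓ r)]

/-- Enlarging the truncation from `R` to `4 R` hardly changes the functional calculus on an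
`r`-condensate: a polynomial of degree `(R - r) / 2` does not see the difference. -/
theorem norm_cfc_truncHop_sub_le {M κ : ℝ} {x : Bool} {ℓ r R : ℕ} {y : Bits n} (hy : y ≠ 0)
    (hM : 0 ≤ M)
    (happ : ∀ Λ D : ℝ, 1 ≤ Λ → 0 ≤ D → PolyApprox Λ D (eFun κ x) (M * Real.exp (-(D / √Λ))))
    (hrR : r ≤ R) (hR : 1 ≤ R) :
    ‖(cfc (eFun κ x) (truncHop ℓ R y) - cfc (eFun κ x) (truncHop ℓ (4 * R) y)) * Con n ℓ r‖
      ≤ 2 * M * Real.exp (-(((R : ℝ) - r) / (26 * √R))) := by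
  have hR1 : (1 : ℝ) ≤ R := by exact_mod_cast hR
  have hD : 0 ≤ ((R : ℝ) - r) / 2 := by
    have : (r : ℝ) ≤ R := by exact_mod_cast hrR
    linarith
  -- `169 R = (13 √R)²` bounds the spectra of both truncated operators
  have hΛ : 32 * (((4 * R : ℕ) : ℝ) + 1) ≤ 169 * R := by push_cast; linarith
  have hΛ' : 32 * ((R : ℝ) + 1) ≤ 169 * R := by linarith
  obtain ⟨p, hp, hpz⟩ := happ (169 * R) (((R : ℝ) - r) / 2) (by linarith) hD
  have hsq : √(169 * (R : ℝ)) = 13 * √R := by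
    rw [Real.sqrt_mul (by norm_num), show (169 : ℝ) = 13 ^ 2 by norm_num,
      Real.sqrt_sq (by norm_num)]
  have hdiv : ((R : ℝ) - r) / 2 / (13 * √R) = ((R : ℝ) - r) / (26 * √R) := by
    rw [div_div]; ring_nf
  rw [hsq, hdiv] at hpz
  set err := M * Real.exp (-(((R : ℝ) - r) / (26 * √R))) with herr
  have herr0 : 0 ≤ err := by positivity
  have hdeg : r + 2 * p.natDegree ≤ R := by
    have : (r : ℝ) + 2 * p.natDegree ≤ R := by linarith
    exact_mod_cast this
  have h1 := norm_cfc_sub_aeval_le (truncHop_posSemidef ℓ R y)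
    ((norm_truncHop_le ℓ R hy).trans hΛ') herr0 hpz
  have h2 := norm_cfc_sub_aeval_le (truncHop_posSemidef ℓ (4 * R) y)
    ((norm_truncHop_le ℓ (4 * R) hy).trans hΛ) herr0 hpz
  have h3 := aeval_truncHop_mul_Con (ℓ := ℓ) hdeg (by omega : R ≤ 4 * R) y
  have h4 : (cfc (eFun κ x) (truncHop ℓ R y) - cfc (eFun κ x) (truncHop ℓ (4 * R) y)) * Con n ℓ r
      = ((cfc (eFun κ x) (truncHop ℓ R y) - Polynomial.aeval (truncHop ℓ R y) p)
        - (cfc (eFun κ x) (truncHop ℓ (4 * R) y) - Polynomial.aeval (truncHop ℓ (4 * R) y) p))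
        * Con n ℓ r := by
    simp only [sub_mul, h3]
    abel
  rw [h4]
  calc _ ≤ (err + err) * 1 := by
        refine (norm_mul_le _ _).trans (mul_le_mul ?_ (norm_Con_le n ℓ r) (norm_nonneg _)
          (by positivity))
        exact (norm_sub_le _ _).trans (add_le_add h1 h2)
    _ = _ := by rw [herr]; ring

theorem hop_zero_sq (ℓ : ℕ) : hop ℓ (0 : Bits n) ^ 2 = (ℓ : ℝ) • 1 := by
  rw [hop_zero, smul_pow, one_pow, ← Complex.ofReal_pow, Real.sq_sqrt (Nat.cast_nonneg _)]
  ext i j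
  simp [Matrix.smul_apply]

theorem cfc_truncHop_zero_mul_Con {ℓ r R : ℕ} (h : r ≤ R) (f : ℝ → ℝ) :
    cfc f (truncHop ℓ R (0 : Bits n)) * Con n ℓ r = f ℓ • Con n ℓ r := by
  refine cfc_mul_of_mul_eq_smul (truncHop_posSemidef ℓ R 0).1 ?_ f
  rw [truncHop, mul_assoc, Con_mul_Con ℓ h, hop_zero_sq, mul_smul_comm, mul_one, smul_mul_assoc,
    Con_mul_Con ℓ h]

/-- On `r`-condensates the Kraus operators are close to those of the hopping operator truncated to
`R`-condensates, uniformly in the number of bosons. The truncation is removed by repeatedly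
quadrupling `R`, with errors decaying doubly exponentially. The zero momentum is special: its hopping
operator is a large multiple of the identity, and there the two sides agree exactly. -/
theorem norm_cfc_hop_sub_cfc_truncHop_le {M κ q : ℝ} {x : Bool} {ℓ r R : ℕ} (y : Bits n)
    (hM : 0 ≤ M)
    (happ : ∀ Λ D : ℝ, 1 ≤ Λ → 0 ≤ D → PolyApprox Λ D (eFun κ x) (M * Real.exp (-(D / √Λ))))
    (hrR : r ≤ R) (hR : 1 ≤ R) (hq : 1 ≤ q) (hqR : q * (26 * √R) ≤ (R : ℝ) - r) :
    ‖(cfc (eFun κ x) (hop ℓ y ^ 2) - cfc (eFun κ x) (truncHop ℓ R y)) * Con n ℓ r‖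
      ≤ 4 * M * Real.exp (-q) := by
  have hJ : ∃ J : ℕ, ℓ ≤ 4 ^ J * R :=
    ⟨ℓ, (Nat.lt_pow_self (by norm_num)).le.trans (Nat.le_mul_of_pos_right _ hR)⟩
  rcases eq_or_ne y 0 with rfl | hy
  · obtain ⟨J, hJ⟩ := hJ
    have hr' : r ≤ 4 ^ J * R := hrR.trans (Nat.le_mul_of_pos_left _ (by positivity))
    rw [← truncHop_of_le hJ, sub_mul, cfc_truncHop_zero_mul_Con hr', cfc_truncHop_zero_mul_Con hrR,
      sub_self, norm_zero]
    positivity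
  have hRpos : (0 : ℝ) < √R := Real.sqrt_pos.2 (by exact_mod_cast hR)
  have hstep : ∀ J : ℕ, ‖(cfc (eFun κ x) (truncHop ℓ (4 ^ J * R) y)
      - cfc (eFun κ x) (truncHop ℓ (4 ^ (J + 1) * R) y)) * Con n ℓ r‖
      ≤ 2 * M * Real.exp (-q) * (1 / 2) ^ J := fun J => by
    have hr' : r ≤ 4 ^ J * R := hrR.trans (Nat.le_mul_of_pos_left _ (by positivity))
    have h := norm_cfc_truncHop_sub_le (ℓ := ℓ) hy hM happ hr' (Nat.mul_pos (by positivity) hR)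
    rw [← mul_assoc, ← pow_succ'] at h
    refine h.trans ?_
    rw [mul_assoc (2 * M)]
    refine mul_le_mul_of_nonneg_left ?_ (by positivity)
    have hsq : √((4 ^ J * R : ℕ) : ℝ) = 2 ^ J * √R := by
      push_cast
      rw [Real.sqrt_mul (by positivity), show (4 : ℝ) ^ J = (2 ^ J) ^ 2 by
        rw [← pow_mul, mul_comm, pow_mul]; norm_num, Real.sqrt_sq (by positivity)]
    have h2J : (1 : ℝ) + J ≤ 2 ^ J := by
      have : J + 1 ≤ 2 ^ J := Nat.lt_two_pow_self
      have : (J : ℝ) + 1 ≤ 2 ^ J := by exact_mod_cast this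
      linarith
    have hge : (2 : ℝ) ^ J * q ≤ ((4 ^ J * R : ℕ) - r : ℝ) / (26 * √((4 ^ J * R : ℕ) : ℝ)) := by
      rw [hsq, le_div_iff₀ (by positivity)]
      have h4 : (4 : ℝ) ^ J = 2 ^ J * 2 ^ J := by rw [← mul_pow]; norm_num
      have h1 : (1 : ℝ) ≤ 2 ^ J * 2 ^ J := by rw [← h4]; exact one_le_pow₀ (by norm_num)
      have hr0 : (0 : ℝ) ≤ r := Nat.cast_nonneg r
      push_cast
      rw [h4]
      calc (2 : ℝ) ^ J * q * (26 * (2 ^ J * √R)) = 2 ^ J * 2 ^ J * (q * (26 * √R)) := by ring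
        _ ≤ 2 ^ J * 2 ^ J * ((R : ℝ) - r) := by gcongr
        _ ≤ _ := by nlinarith
    have hhalf : Real.exp (-1) ≤ 1 / 2 := by
      rw [Real.exp_neg, one_div]
      gcongr
      have := Real.add_one_le_exp (1 : ℝ)
      linarith
    calc Real.exp (-(((4 ^ J * R : ℕ) - r : ℝ) / (26 * √((4 ^ J * R : ℕ) : ℝ))))
        ≤ Real.exp (-q + J * (-1)) := by
          refine Real.exp_le_exp.2 ?_
          have hJ0 : (0 : ℝ) ≤ J := Nat.cast_nonneg J
          nlinarith
      _ = Real.exp (-q) * Real.exp (-1) ^ J := by rw [Real.exp_add, Real.exp_nat_mul]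
      _ ≤ _ := by gcongr
  have htel : ∀ J : ℕ, ‖(cfc (eFun κ x) (truncHop ℓ R y)
      - cfc (eFun κ x) (truncHop ℓ (4 ^ J * R) y)) * Con n ℓ r‖
      ≤ 4 * M * Real.exp (-q) * (1 - (1 / 2) ^ J) := fun J => by
    induction J with
    | zero => simp
    | succ J ih =>
      have h1 : (cfc (eFun κ x) (truncHop ℓ R y) - cfc (eFun κ x) (truncHop ℓ (4 ^ (J + 1) * R) y))
          * Con n ℓ r = (cfc (eFun κ x) (truncHop ℓ R y) - cfc (eFun κ x) (truncHop ℓ (4 ^ J * R) y))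
          * Con n ℓ r + (cfc (eFun κ x) (truncHop ℓ (4 ^ J * R) y)
            - cfc (eFun κ x) (truncHop ℓ (4 ^ (J + 1) * R) y)) * Con n ℓ r := by
        rw [← add_mul, sub_add_sub_cancel]
      rw [h1]
      refine (norm_add_le _ _).trans ((add_le_add ih (hstep J)).trans (le_of_eq ?_))
      rw [pow_succ]; ring
  obtain ⟨J, hJ⟩ := hJ
  rw [← truncHop_of_le hJ, ← norm_neg, ← neg_mul, neg_sub]
  refine (htel J).trans (mul_le_of_le_one_right (by positivity) ?_)
  have : (0 : ℝ) ≤ (1 / 2) ^ J := by positivity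
  linarith

theorem kraus_eq (ℓ : ℕ) (κ : ℝ) (x : Bool) (y : Bits n) :
    kraus ℓ κ x y = cfc (eFun κ x) (hop ℓ y ^ 2) := by
  rw [hop_sq_eq_diagonal, cfc_diagonal, kraus]

/-- Functions of the truncated operator preserve `R`-condensates. -/
theorem commute_Con_cfc_truncHop (ℓ R : ℕ) (y : Bits n) (f : ℝ → ℝ) :
    Commute (Con n ℓ R) (cfc f (truncHop ℓ R y)) := by
  have h : Commute (truncHop ℓ R y) (Con n ℓ R) := by
    rw [commute_iff_eq, truncHop, mul_assoc, Con_mul_Con ℓ le_rfl]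
    simp only [← mul_assoc]
    rw [Con_mul_Con ℓ le_rfl]
  exact (h.cfc_real f).symm

end

section
open scoped Matrix.Norms.L2Operator

/-! ### Block-diagonal operators -/

/-- The block-diagonal operator on `α × ι` whose block at `a` is `f (π a)`: the operator `f`
controlled by the value of `π` on the first register. -/
def controlled {α β ι : Type*} [Fintype α] [DecidableEq α] [Fintype ι] [DecidableEq ι] (π : α → β) :
    (β → Matrix ι ι ℂ) →⋆ₐ[ℂ] Matrix (α × ι) (α × ι) ℂ where
  toFun f := Matrix.of fun p p' => if p.1 = p'.1 then f (π p.1) p.2 p'.2 else 0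
  map_one' := by
    ext ⟨a, i⟩ ⟨a', i'⟩
    by_cases h : a = a' <;> simp [Matrix.one_apply, h]
  map_mul' f g := by
    ext ⟨a, i⟩ ⟨a', i'⟩
    simp only [Matrix.of_apply, Matrix.mul_apply, Pi.mul_apply, Fintype.sum_prod_type]
    rw [Finset.sum_eq_single a (fun b _ hb => by simp [hb.symm]) (by simp)]
    by_cases h : a = a' <;> simp [h]
  map_zero' := by ext; simp
  map_add' f g := by
    ext ⟨a, i⟩ ⟨a', i'⟩
    by_cases h : a = a' <;> simp [h]
  commutes' c := by
    ext ⟨a, i⟩ ⟨a', i'⟩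
    by_cases h : a = a' <;> simp [Matrix.algebraMap_matrix_apply, h]
  map_star' f := by
    ext ⟨a, i⟩ ⟨a', i'⟩
    by_cases h : a = a'
    · subst h; simp [Matrix.star_apply]
    · simp [Matrix.star_apply, h, Ne.symm h]

section controlled

variable {α β ι : Type*} [Fintype α] [DecidableEq α] [Fintype ι] [DecidableEq ι]

theorem controlled_apply (π : α → β) (f : β → Matrix ι ι ℂ) (p p' : α × ι) :
    controlled π f p p' = if p.1 = p'.1 then f (π p.1) p.2 p'.2 else 0 := rfl

theorem controlled_const (π : α → β) (M : Matrix ι ι ℂ) :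
    controlled π (fun _ => M) = (1 : Matrix α α ℂ) ⊗ₖ M := by
  ext ⟨a, i⟩ ⟨a', i'⟩
  rw [controlled_apply, Matrix.kronecker_apply, Matrix.one_apply]
  split_ifs <;> simp

theorem norm_controlled_le [Fintype β] (π : α → β) {f : β → Matrix ι ι ℂ} {c : ℝ} (hc : 0 ≤ c)
    (h : ∀ b, ‖f b‖ ≤ c) : ‖controlled π f‖ ≤ c :=
  (NonUnitalStarAlgHom.norm_apply_le (controlled π) f).trans ((pi_norm_le_iff_of_nonneg hc).2 h)

theorem norm_one_kronecker_le (M : Matrix ι ι ℂ) : ‖(1 : Matrix α α ℂ) ⊗ₖ M‖ ≤ ‖M‖ := by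
  rw [← controlled_const (fun _ => ())]
  exact norm_controlled_le _ (norm_nonneg _) fun _ => le_rfl

theorem kronecker_one_mem_unitaryGroup {U : Matrix α α ℂ} (hU : U ∈ Matrix.unitaryGroup α ℂ) :
    U ⊗ₖ (1 : Matrix ι ι ℂ) ∈ Matrix.unitaryGroup (α × ι) ℂ :=
  Matrix.kronecker_mem_unitary hU (one_mem _)

theorem norm_unitary_kronecker_le {U : Matrix α α ℂ} (hU : U ∈ Matrix.unitaryGroup α ℂ)
    (M : Matrix ι ι ℂ) : ‖U ⊗ₖ M‖ ≤ ‖M‖ := by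
  have h : U ⊗ₖ M = (U ⊗ₖ (1 : Matrix ι ι ℂ)) * ((1 : Matrix α α ℂ) ⊗ₖ M) := by
    rw [← Matrix.mul_kronecker_mul, mul_one, one_mul]
  rw [h]
  calc _ ≤ 1 * ‖M‖ := (norm_mul_le _ _).trans (mul_le_mul
        (norm_le_one_of_mem_unitaryGroup (kronecker_one_mem_unitaryGroup hU))
        (norm_one_kronecker_le M) (norm_nonneg _) zero_le_one)
    _ = _ := one_mul _

theorem norm_le_one_of_isHermitian_of_mul_self {P : Matrix ι ι ℂ} (h : P.IsHermitian)
    (hP : P * P = P) : ‖P‖ ≤ 1 := by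
  have h' := Matrix.l2_opNorm_conjTranspose_mul_self P
  rw [h.eq, hP] at h'
  nlinarith [norm_nonneg P]

end controlled

/-! ### Time-ordered products -/

section timeOrdered

variable {ι ι' : Type} [Fintype ι] [DecidableEq ι] [Fintype ι'] [DecidableEq ι']

theorem timeOrdered_succ {T : ℕ} (F : Fin (T + 1) → Matrix ι ι ℂ) :
    timeOrdered F = timeOrdered (fun i => F i.succ) * F 0 := by
  simp [timeOrdered, List.ofFn_succ]

theorem timeOrdered_zero (F : Fin 0 → Matrix ι ι ℂ) : timeOrdered F = 1 := by
  simp [timeOrdered]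

theorem timeOrdered_const (T : ℕ) (M : Matrix ι ι ℂ) :
    timeOrdered (fun _ : Fin T => M) = M ^ T := by
  simp [timeOrdered, List.ofFn_const]

theorem timeOrdered_kronecker {T : ℕ} (F : Fin T → Matrix ι ι ℂ) (G : Fin T → Matrix ι' ι' ℂ) :
    timeOrdered F ⊗ₖ timeOrdered G = timeOrdered fun i => F i ⊗ₖ G i := by
  induction T with
  | zero => simp only [timeOrdered_zero, Matrix.one_kronecker_one]
  | succ T ih => rw [timeOrdered_succ, timeOrdered_succ, timeOrdered_succ, Matrix.mul_kronecker_mul, ih]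

/-- Distributivity of time-ordered products over sums. -/
theorem sum_timeOrdered {T : ℕ} (κ : Fin T → Type) [∀ i, Fintype (κ i)]
    (F : ∀ i, κ i → Matrix ι ι ℂ) :
    ∑ x : ∀ i, κ i, timeOrdered (fun i => F i (x i)) = timeOrdered fun i => ∑ a, F i a := by
  induction T with
  | zero => simp [timeOrdered_zero]
  | succ T ih =>
    rw [timeOrdered_succ, ← ih (fun i => κ i.succ) fun i => F i.succ,
      ← (Fin.consEquiv κ).sum_comp, Fintype.sum_prod_type, Finset.sum_mul_sum, Finset.sum_comm]
    refine Finset.sum_congr rfl fun x _ => Finset.sum_congr rfl fun a _ => ?_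
    rw [timeOrdered_succ]
    simp [Fin.consEquiv]

end timeOrdered

/-! ### The queries as operators -/

-- the instances on the joint index type of all registers exceed the default bound
set_option synthInstance.maxSize 1024

variable {n m ℓ : ℕ}

/-- The query `∑_x K^x ⊗ B_x` at the string `y`. -/
def oracle (B : Bool → Bits n → Matrix (Occ n ℓ) (Occ n ℓ) ℂ) (y : Bits n) :
    Matrix (URegister n × Occ n ℓ) (URegister n × Occ n ℓ) ℂ :=
  ∑ x, Kop x y ⊗ₖ B x y

/-- The query controlled by the control bit. -/
def query (B : Bool → Bits n → Matrix (Occ n ℓ) (Occ n ℓ) ℂ) (q : Bool × Bits n) :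
    Matrix (URegister n × Occ n ℓ) (URegister n × Occ n ℓ) ℂ :=
  if q.1 = true then oracle B q.2 else 1

/-- The control bit and the query string of a basis state of the algorithm's register. -/
def queryIndex {n m : ℕ} (a : ARegister n m) : Bool × Bits n := (a.1, a.2.1)

/-- One query followed by one application of the algorithm's unitary. -/
def stepOp (A : Matrix (ARegister n m) (ARegister n m) ℂ)
    (B : Bool → Bits n → Matrix (Occ n ℓ) (Occ n ℓ) ℂ) :
    Matrix (ARegister n m × (URegister n × Occ n ℓ)) (ARegister n m × (URegister n × Occ n ℓ)) ℂ :=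
  A ⊗ₖ (1 : Matrix (URegister n × Occ n ℓ) (URegister n × Occ n ℓ) ℂ) *
    controlled queryIndex (query B)

/-- The state before the first query. -/
def startState (ℓ : ℕ) (A : Matrix (ARegister n m) (ARegister n m) ℂ) :
    ARegister n m × (URegister n × Occ n ℓ) → ℂ :=
  fun p => (A *ᵥ initA n m) p.1 * (initU n p.2.1 * initS n ℓ p.2.2)

theorem sum_controlledProd {T : ℕ} (B : Bool → Bits n → Matrix (Occ n ℓ) (Occ n ℓ) ℂ)
    (y : Fin T → Bits n) (b : Fin T → Bool) :
    ∑ x : {i : Fin T // b i = true} → Bool, controlledProd Kop y b x ⊗ₖ controlledProd B y b x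
      = timeOrdered fun i => query B (b i, y i) := by
  -- a bit for every active query is a family indexed by all queries, with one value at inactive ones
  let e : ({i : Fin T // b i = true} → Bool) ≃ (∀ i : Fin T, b i = true → Bool) :=
    ⟨fun x i h => x ⟨i, h⟩, fun x i => x i.1 i.2, fun _ => rfl, fun _ => rfl⟩
  let F : ∀ i : Fin T, (b i = true → Bool) →
      Matrix (URegister n × Occ n ℓ) (URegister n × Occ n ℓ) ℂ := fun i x =>
    if h : b i = true then Kop (x h) (y i) ⊗ₖ B (x h) (y i) else 1
  have h1 : ∀ x : {i : Fin T // b i = true} → Bool,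
      controlledProd Kop y b x ⊗ₖ controlledProd B y b x = timeOrdered fun i => F i (e x i) := by
    intro x
    rw [controlledProd, controlledProd, timeOrdered_kronecker]
    congr 1
    funext i
    simp only [F, e, Equiv.coe_fn_mk]
    split_ifs
    · rfl
    · exact Matrix.one_kronecker_one
  simp only [h1]
  rw [e.sum_comp fun x => timeOrdered fun i => F i (x i), sum_timeOrdered]
  congr 1
  funext i
  by_cases hb : b i = true
  · let e' : (b i = true → Bool) ≃ Bool := ⟨fun f => f hb, fun a _ => a, fun _ => rfl, fun _ => rfl⟩
    rw [query, if_pos hb, oracle, ← e'.sum_comp]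
    exact Finset.sum_congr rfl fun x _ => dif_pos hb
  · rw [Fintype.sum_eq_single (fun h => absurd h hb)
      fun x hx => absurd (funext fun h => absurd h hb) hx, query, if_neg hb]
    exact dif_neg hb

theorem sum_queryProd_kronecker (A : Matrix (ARegister n m) (ARegister n m) ℂ)
    (B : Bool → Bits n → Matrix (Occ n ℓ) (Occ n ℓ) ℂ) :
    ∑ q : Bool × Bits n, (A * queryProj m q.1 q.2) ⊗ₖ query B q = stepOp A B := by
  have h1 : ∀ q : Bool × Bits n, (A * queryProj m q.1 q.2) ⊗ₖ query B q
      = A ⊗ₖ (1 : Matrix (URegister n × Occ n ℓ) (URegister n × Occ n ℓ) ℂ) *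
        (queryProj m q.1 q.2 ⊗ₖ query B q) := fun q => by
    rw [← Matrix.mul_kronecker_mul, one_mul]
  simp only [h1]
  rw [← Finset.mul_sum, stepOp]
  congr 1
  ext ⟨a, i⟩ ⟨a', i'⟩
  rw [Matrix.sum_apply, controlled_apply]
  simp only [Matrix.kronecker_apply, queryProj, Matrix.diagonal_apply]
  rw [Finset.sum_eq_single (queryIndex a)]
  · by_cases h : a = a' <;> simp [h, queryIndex]
  · intro q _ hq
    have : ¬ (a.1 = q.1 ∧ a.2.1 = q.2) := fun h => hq (Prod.ext h.1.symm h.2.symm)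
    simp [this]
  · simp

/-- The state of the algorithm is produced by iterating one operator. -/
theorem algState_eq (T : ℕ) (A : Matrix (ARegister n m) (ARegister n m) ℂ)
    (B : Bool → Bits n → Matrix (Occ n ℓ) (Occ n ℓ) ℂ) :
    algState T A B = WithLp.toLp 2 ((stepOp A B ^ T) *ᵥ startState ℓ A) := by
  have hmat : ∑ y : Fin T → Bits n, ∑ b : Fin T → Bool,
      (timeOrdered (fun i => A * queryProj m (b i) (y i)) ⊗ₖ
        ∑ x : {i : Fin T // b i = true} → Bool,
          controlledProd Kop y b x ⊗ₖ controlledProd B y b x) = stepOp A B ^ T := by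
    simp only [sum_controlledProd, timeOrdered_kronecker]
    rw [Finset.sum_comm, ← Fintype.sum_prod_type']
    let e : (Fin T → Bool × Bits n) ≃ (Fin T → Bool) × (Fin T → Bits n) :=
      Equiv.arrowProdEquivProdArrow _ _ _
    rw [← e.sum_comp, ← timeOrdered_const, ← sum_queryProd_kronecker]
    exact sum_timeOrdered (fun _ => Bool × Bits n)
      fun _ q => (A * queryProj m q.1 q.2) ⊗ₖ query B q
  rw [algState, ← hmat]
  congr 1
  simp only [Matrix.sum_mulVec]
  rfl

/-! ### The Pauli operators and unitarity of queries -/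

theorem pauliZ_mul_self (y : Bits n) : pauliZ y * pauliZ y = 1 := by
  rw [pauliZ, Matrix.diagonal_mul_diagonal, ← Matrix.diagonal_one]
  congr 1
  funext w
  split_ifs <;> simp

theorem flip_flip (w : URegister n) (y : Bits n) :
    Function.update (Function.update w y (!w y)) y (!(Function.update w y (!w y)) y) = w := by
  simp

theorem eq_flip_comm (w v : URegister n) (y : Bits n) :
    w = Function.update v y (!v y) ↔ v = Function.update w y (!w y) := by
  constructor
  · rintro rfl; exact (flip_flip v y).symm
  · rintro rfl; exact (flip_flip w y).symm

theorem pauliX_mul_apply (y : Bits n) (N : Matrix (URegister n) (URegister n) ℂ)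
    (w w' : URegister n) : (pauliX y * N) w w' = N (Function.update w y (!w y)) w' := by
  rw [Matrix.mul_apply]
  simp only [pauliX, Matrix.of_apply, eq_flip_comm w, ite_mul, one_mul, zero_mul,
    Finset.sum_ite_eq', Finset.mem_univ, if_true]

theorem pauliX_mul_self (y : Bits n) : pauliX y * pauliX y = 1 := by
  ext w w'
  rw [pauliX_mul_apply, pauliX, Matrix.of_apply, Matrix.one_apply]
  simp only [eq_flip_comm (Function.update w y (!w y)), flip_flip, eq_comm]

theorem pauliZ_mul_pauliX (y : Bits n) : pauliZ y * pauliX y = -(pauliX y * pauliZ y) := by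
  ext w w'
  rw [Matrix.neg_apply, pauliX_mul_apply, pauliZ, Matrix.diagonal_mul, Matrix.diagonal_apply, pauliX,
    Matrix.of_apply]
  by_cases h : w = Function.update w' y (!w' y)
  · have h' := (eq_flip_comm w w' y).1 h
    rw [if_pos h, if_pos h'.symm, Function.update_self]
    cases w y <;> simp
  · have h' : Function.update w y (!w y) ≠ w' := fun h' => h ((eq_flip_comm w w' y).2 h'.symm)
    rw [if_neg h, if_neg h', mul_zero, neg_zero]

theorem Kop_isHermitian (x : Bool) (y : Bits n) : (Kop x y).IsHermitian := by
  cases x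
  · rw [Kop, if_neg (by simp), pauliZ]
    refine Matrix.isHermitian_diagonal_of_self_adjoint _ ?_
    rw [isSelfAdjoint_iff]
    funext w
    rw [Pi.star_apply]
    split_ifs <;> simp
  · rw [Kop, if_pos rfl]
    ext w w'
    rw [Matrix.conjTranspose_apply, pauliX, Matrix.of_apply, Matrix.of_apply]
    simp only [eq_flip_comm w' w]
    split_ifs <;> simp

theorem Kop_mul_self (x : Bool) (y : Bits n) : Kop x y * Kop x y = 1 := by
  cases x
  · exact pauliZ_mul_self y
  · exact pauliX_mul_self y

theorem Kop_mem_unitaryGroup (x : Bool) (y : Bits n) :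
    Kop x y ∈ Matrix.unitaryGroup (URegister n) ℂ := by
  rw [Matrix.mem_unitaryGroup_iff, Matrix.star_eq_conjTranspose, (Kop_isHermitian x y).eq,
    Kop_mul_self]

/-- A query with commuting Hermitian `B_0, B_1` such that `B_0² + B_1² = 1` is unitary, since the two
Pauli operators anticommute. -/
theorem norm_oracle_le {B : Bool → Bits n → Matrix (Occ n ℓ) (Occ n ℓ) ℂ} {y : Bits n}
    (hB : ∀ x, (B x y).IsHermitian) (hc : Commute (B false y) (B true y))
    (h1 : B false y * B false y + B true y * B true y = 1) : ‖oracle B y‖ ≤ 1 := by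
  refine norm_le_one_of_mem_unitaryGroup (Matrix.mem_unitaryGroup_iff.2 ?_)
  have hs : star (oracle B y) = oracle B y := by
    rw [oracle, star_sum]
    refine Finset.sum_congr rfl fun x _ => ?_
    rw [Matrix.star_eq_conjTranspose, Matrix.conjTranspose_kronecker, (Kop_isHermitian x y).eq,
      (hB x).eq]
  have hzx : Kop false y * Kop true y = -(Kop true y * Kop false y) := pauliZ_mul_pauliX y
  rw [hs, oracle, Fintype.sum_bool, add_mul, mul_add, mul_add]
  simp only [← Matrix.mul_kronecker_mul, Kop_mul_self, hzx, hc.eq]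
  have hneg : (-(Kop true y * Kop false y)) ⊗ₖ (B true y * B false y)
      = -((Kop true y * Kop false y) ⊗ₖ (B true y * B false y)) := by
    ext p p'
    rw [Matrix.neg_apply, Matrix.kronecker_apply, Matrix.kronecker_apply, Matrix.neg_apply, neg_mul]
  rw [hneg]
  calc _ = (1 : Matrix (URegister n) (URegister n) ℂ) ⊗ₖ
        (B false y * B false y + B true y * B true y) := by
        rw [Matrix.kronecker_add]; abel
    _ = 1 := by rw [h1, Matrix.one_kronecker_one]

theorem eFun_sq_add (κ z : ℝ) (hκ : 0 ≤ κ) (hz : 0 ≤ z) :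
    eFun κ false z * eFun κ false z + eFun κ true z * eFun κ true z = 1 := by
  have h1 : Real.exp (-κ * z) ≤ 1 := Real.exp_le_one_iff.2 (by nlinarith)
  have h0 := Real.exp_pos (-κ * z)
  simp only [eFun, if_true]
  rw [if_neg (by simp), Real.mul_self_sqrt (mul_nonneg h0.le (by linarith))]
  ring

theorem norm_oracle_cfc_le {κ : ℝ} (hκ : 0 ≤ κ) (R : ℕ) (y : Bits n) :
    ‖oracle (fun x y => cfc (eFun κ x) (truncHop ℓ R y)) y‖ ≤ 1 := by
  have hH := truncHop_posSemidef ℓ R y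
  refine norm_oracle_le (fun x => cfc_predicate _ _) (cfc_commute_cfc _ _ _) ?_
  rw [← cfc_mul _ _ _ (continuousOn_spectrum _ _) (continuousOn_spectrum _ _),
    ← cfc_mul _ _ _ (continuousOn_spectrum _ _) (continuousOn_spectrum _ _),
    ← cfc_add _ _ _ (continuousOn_spectrum _ _) (continuousOn_spectrum _ _),
    ← cfc_one ℝ (truncHop ℓ R y) hH.1.isSelfAdjoint]
  exact cfc_congr fun z hz => eFun_sq_add κ z hκ (nonneg_of_mem_spectrum hH hz)

end

section
open scoped Matrix.Norms.L2Operator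

-- the instances on the joint index type of all registers exceed the default bound
set_option synthInstance.maxSize 1024

/-! ### The hybrid argument -/

section hybrid

variable {ι : Type*} [Fintype ι]

/-- The Euclidean norm of a coordinate vector. -/
def vecNorm (v : ι → ℂ) : ℝ := ‖WithLp.toLp 2 v‖

theorem vecNorm_add_le (v w : ι → ℂ) : vecNorm (v + w) ≤ vecNorm v + vecNorm w :=
  norm_add_le (WithLp.toLp 2 v) (WithLp.toLp 2 w)

theorem vecNorm_nonneg (v : ι → ℂ) : 0 ≤ vecNorm v := norm_nonneg _

variable [DecidableEq ι]

theorem vecNorm_mulVec_le (M : Matrix ι ι ℂ) (v : ι → ℂ) : vecNorm (M *ᵥ v) ≤ ‖M‖ * vecNorm v :=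
  Matrix.l2_opNorm_mulVec M (WithLp.toLp 2 v)

theorem vecNorm_mulVec_le_of_le {M : Matrix ι ι ℂ} {v : ι → ℂ} {c : ℝ} (hM : ‖M‖ ≤ c)
    (hv : vecNorm v ≤ 1) : vecNorm (M *ᵥ v) ≤ c := by
  have := norm_nonneg M
  calc _ ≤ ‖M‖ * vecNorm v := vecNorm_mulVec_le M v
    _ ≤ c * 1 := mul_le_mul hM hv (vecNorm_nonneg v) (this.trans hM)
    _ = c := mul_one c

theorem vecNorm_mulVec_le_self {M : Matrix ι ι ℂ} (hM : ‖M‖ ≤ 1) (v : ι → ℂ) :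
    vecNorm (M *ᵥ v) ≤ vecNorm v :=
  (vecNorm_mulVec_le M v).trans (mul_le_of_le_one_left (vecNorm_nonneg v) hM)

theorem vecNorm_pow_mulVec_le {S : Matrix ι ι ℂ} (hS : ‖S‖ ≤ 1) {v : ι → ℂ} (hv : vecNorm v ≤ 1)
    (t : ℕ) : vecNorm ((S ^ t) *ᵥ v) ≤ 1 := by
  induction t with
  | zero => simpa using hv
  | succ t ih =>
    rw [pow_succ', ← Matrix.mulVec_mulVec]
    exact (vecNorm_mulVec_le_self hS _).trans ih

/-- If one step of a contraction leaks at most `ε` from the range of `P t` to outside the range of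
`P (t + 1)`, then after `t` steps at most `t ε` has leaked. -/
theorem vecNorm_leak_le {S : Matrix ι ι ℂ} {P : ℕ → Matrix ι ι ℂ} {v : ι → ℂ} {ε : ℝ} (hS : ‖S‖ ≤ 1)
    (hv : vecNorm v ≤ 1) (hP : ∀ t, ‖1 - P t‖ ≤ 1) (h0 : P 0 *ᵥ v = v)
    (hleak : ∀ t, ‖(1 - P (t + 1)) * S * P t‖ ≤ ε) (t : ℕ) :
    vecNorm ((1 - P t) *ᵥ ((S ^ t) *ᵥ v)) ≤ t * ε := by
  induction t with
  | zero => simp [Matrix.sub_mulVec, h0, vecNorm]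
  | succ t ih =>
    set w := (S ^ t) *ᵥ v
    have hw : (S ^ (t + 1)) *ᵥ v = S *ᵥ w := by rw [pow_succ', ← Matrix.mulVec_mulVec]
    have hsplit : (1 - P (t + 1)) *ᵥ (S *ᵥ w) = ((1 - P (t + 1)) * S * P t) *ᵥ w
        + ((1 - P (t + 1)) * S) *ᵥ ((1 - P t) *ᵥ w) := by
      simp only [Matrix.sub_mulVec, Matrix.mulVec_sub, ← Matrix.mulVec_mulVec, Matrix.one_mulVec]
      abel
    have hc : ‖(1 - P (t + 1)) * S‖ ≤ 1 :=
      (norm_mul_le _ _).trans (mul_le_one₀ (hP _) (norm_nonneg _) hS)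
    rw [hw, hsplit]
    refine (vecNorm_add_le _ _).trans ?_
    have h1 := vecNorm_mulVec_le_of_le (hleak t) (vecNorm_pow_mulVec_le hS hv t)
    have h2 := (vecNorm_mulVec_le_self hc ((1 - P t) *ᵥ w)).trans ih
    push_cast
    linarith

/-- Replacing a contraction step by step by another one. -/
theorem vecNorm_pow_sub_pow_le {S S' : Matrix ι ι ℂ} {v : ι → ℂ} {δ : ℝ} (hS' : ‖S'‖ ≤ 1) (T : ℕ)
    (h : ∀ t < T, vecNorm ((S - S') *ᵥ ((S ^ t) *ᵥ v)) ≤ δ) :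
    vecNorm ((S ^ T) *ᵥ v - (S' ^ T) *ᵥ v) ≤ T * δ := by
  induction T with
  | zero => simp [vecNorm]
  | succ T ih =>
    have hsplit : (S ^ (T + 1)) *ᵥ v - (S' ^ (T + 1)) *ᵥ v
        = (S - S') *ᵥ ((S ^ T) *ᵥ v) + S' *ᵥ ((S ^ T) *ᵥ v - (S' ^ T) *ᵥ v) := by
      rw [pow_succ', pow_succ', ← Matrix.mulVec_mulVec, ← Matrix.mulVec_mulVec, Matrix.sub_mulVec,
        Matrix.mulVec_sub]
      abel
    rw [hsplit]
    refine (vecNorm_add_le _ _).trans ?_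
    have h1 := h T (Nat.lt_succ_self T)
    have h2 := (vecNorm_mulVec_le_self hS' ((S ^ T) *ᵥ v - (S' ^ T) *ᵥ v)).trans
      (ih fun t ht => h t (Nat.lt_succ_of_lt ht))
    push_cast
    linarith

end hybrid

variable {n m ℓ : ℕ}

/-! ### Queries on condensates -/

/-- The projector onto `r`-condensates, tensored with the identity of the register of qubits. -/
def conU (n ℓ r : ℕ) : Matrix (URegister n × Occ n ℓ) (URegister n × Occ n ℓ) ℂ :=
  (1 : Matrix (URegister n) (URegister n) ℂ) ⊗ₖ Con n ℓ r

theorem conU_mul_conU (ℓ : ℕ) {r s : ℕ} (h : r ≤ s) : conU n ℓ s * conU n ℓ r = conU n ℓ r := by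
  rw [conU, conU, ← Matrix.mul_kronecker_mul, one_mul, Con_mul_Con ℓ h]

theorem norm_conU_le (n ℓ r : ℕ) : ‖conU n ℓ r‖ ≤ 1 :=
  (norm_one_kronecker_le _).trans (norm_Con_le n ℓ r)

theorem norm_one_sub_conU_le (n ℓ r : ℕ) : ‖1 - conU n ℓ r‖ ≤ 1 := by
  refine norm_le_one_of_isHermitian_of_mul_self ?_ ?_
  · refine Matrix.isHermitian_one.sub ?_
    rw [Matrix.IsHermitian, conU, Matrix.conjTranspose_kronecker, Matrix.conjTranspose_one,
      (Con_isHermitian n ℓ r).eq]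
  · rw [sub_mul, one_mul, mul_sub, mul_one, conU_mul_conU ℓ le_rfl, sub_self, sub_zero]

/-- The Kraus operators of the hopping operator truncated to `R`-condensates. -/
def truncKraus (ℓ : ℕ) (κ : ℝ) (R : ℕ) (x : Bool) (y : Bits n) : Matrix (Occ n ℓ) (Occ n ℓ) ℂ :=
  cfc (eFun κ x) (truncHop ℓ R y)

theorem norm_oracle_truncKraus_le {κ : ℝ} (hκ : 0 ≤ κ) (R : ℕ) (y : Bits n) :
    ‖oracle (truncKraus ℓ κ R) y‖ ≤ 1 := norm_oracle_cfc_le hκ R y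

theorem kraus_eq_truncKraus (ℓ : ℕ) (κ : ℝ) :
    (kraus ℓ κ : Bool → Bits n → Matrix (Occ n ℓ) (Occ n ℓ) ℂ) = truncKraus ℓ κ ℓ := by
  funext x y
  rw [kraus_eq, truncKraus, truncHop_of_le le_rfl]

theorem oracle_sandwich (κ : ℝ) (r R : ℕ) (y : Bits n) :
    oracle (sandwich ℓ κ r R) y = conU n ℓ r * oracle (truncKraus ℓ κ R) y * conU n ℓ r := by
  rw [oracle, oracle, Finset.mul_sum, Finset.sum_mul]
  refine Finset.sum_congr rfl fun x _ => ?_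
  rw [conU, ← Matrix.mul_kronecker_mul, ← Matrix.mul_kronecker_mul, one_mul, mul_one]
  rfl

/-- The precision to which a query respects the truncation, given the constant `M` of the polynomial
approximation and the rate `q`. -/
theorem norm_oracle_sub_mul_conU_le {M κ q : ℝ} {r R : ℕ} (y : Bits n) (hM : 0 ≤ M)
    (happ : ∀ (x : Bool) (Λ D : ℝ), 1 ≤ Λ → 0 ≤ D →
      PolyApprox Λ D (eFun κ x) (M * Real.exp (-(D / √Λ))))
    (hrR : r ≤ R) (hR : 1 ≤ R) (hq : 1 ≤ q) (hqR : q * (26 * √R) ≤ (R : ℝ) - r) :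
    ‖(oracle (kraus ℓ κ) y - oracle (truncKraus ℓ κ R) y) * conU n ℓ r‖
      ≤ 8 * M * Real.exp (-q) := by
  have h1 : (oracle (kraus ℓ κ) y - oracle (truncKraus ℓ κ R) y) * conU n ℓ r
      = ∑ x, Kop x y ⊗ₖ ((kraus ℓ κ x y - truncKraus ℓ κ R x y) * Con n ℓ r) := by
    rw [oracle, oracle, ← Finset.sum_sub_distrib, Finset.sum_mul]
    refine Finset.sum_congr rfl fun x _ => ?_
    rw [conU, sub_mul, ← Matrix.mul_kronecker_mul, ← Matrix.mul_kronecker_mul, mul_one, sub_mul]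
    ext p p'
    rw [Matrix.sub_apply, Matrix.kronecker_apply, Matrix.kronecker_apply, Matrix.kronecker_apply,
      Matrix.sub_apply, mul_sub]
  have h2 : ∀ x, ‖Kop x y ⊗ₖ ((kraus ℓ κ x y - truncKraus ℓ κ R x y) * Con n ℓ r)‖
      ≤ 4 * M * Real.exp (-q) := fun x => by
    refine (norm_unitary_kronecker_le (Kop_mem_unitaryGroup x y) _).trans ?_
    rw [kraus_eq, truncKraus]
    exact norm_cfc_hop_sub_cfc_truncHop_le y hM (happ x) hrR hR hq hqR
  rw [h1, Fintype.sum_bool]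
  refine (norm_add_le _ _).trans ((add_le_add (h2 true) (h2 false)).trans (le_of_eq ?_))
  ring

theorem commute_conU_oracle_truncKraus (κ : ℝ) (R : ℕ) (y : Bits n) :
    Commute (conU n ℓ R) (oracle (truncKraus ℓ κ R) y) := by
  refine Commute.sum_right _ _ _ fun x _ => ?_
  rw [commute_iff_eq, conU, ← Matrix.mul_kronecker_mul, ← Matrix.mul_kronecker_mul, one_mul, mul_one]
  rw [truncKraus, (commute_Con_cfc_truncHop ℓ R y _).eq]

/-- Queries leak little from `r`-condensates to outside the `R`-condensates, because the truncated
queries do not leak at all. -/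
theorem norm_oracle_leak_le {κ ε : ℝ} {r R : ℕ} (hrR : r ≤ R) (y : Bits n)
    (h : ‖(oracle (kraus ℓ κ) y - oracle (truncKraus ℓ κ R) y) * conU n ℓ r‖ ≤ ε) :
    ‖(1 - conU n ℓ R) * oracle (kraus ℓ κ) y * conU n ℓ r‖ ≤ ε := by
  have h0 : (1 - conU n ℓ R) * oracle (truncKraus ℓ κ R) y * conU n ℓ r = 0 := by
    rw [sub_mul, one_mul, (commute_conU_oracle_truncKraus κ R y).eq, sub_mul, mul_assoc _ (conU n ℓ R),
      conU_mul_conU ℓ hrR, sub_self]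
  have h1 : (1 - conU n ℓ R) * oracle (kraus ℓ κ) y * conU n ℓ r
      = (1 - conU n ℓ R) * ((oracle (kraus ℓ κ) y - oracle (truncKraus ℓ κ R) y) * conU n ℓ r) := by
    rw [sub_mul (oracle (kraus ℓ κ) y), mul_sub, ← mul_assoc, ← mul_assoc, h0, sub_zero]
  rw [h1]
  calc _ ≤ 1 * ε := (norm_mul_le _ _).trans
        (mul_le_mul (norm_one_sub_conU_le n ℓ R) h (norm_nonneg _) zero_le_one)
    _ = ε := one_mul ε

/-! ### The algorithm -/

/-- The projector onto `r`-condensates on all registers. -/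
def conA (n m ℓ r : ℕ) :
    Matrix (ARegister n m × (URegister n × Occ n ℓ)) (ARegister n m × (URegister n × Occ n ℓ)) ℂ :=
  controlled queryIndex fun _ => conU n ℓ r

theorem conA_commute (A : Matrix (ARegister n m) (ARegister n m) ℂ) (r : ℕ) :
    Commute (conA n m ℓ r) (A ⊗ₖ 1) := by
  rw [commute_iff_eq, conA, controlled_const, ← Matrix.mul_kronecker_mul, ← Matrix.mul_kronecker_mul,
    one_mul, mul_one, one_mul, mul_one]

theorem one_sub_conA (r : ℕ) : 1 - conA n m ℓ r = controlled queryIndex fun _ => 1 - conU n ℓ r := by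
  rw [conA, ← map_one (controlled queryIndex), ← map_sub]
  rfl

theorem norm_one_sub_conA_le (r : ℕ) : ‖1 - conA n m ℓ r‖ ≤ 1 := by
  rw [one_sub_conA]
  exact norm_controlled_le _ zero_le_one fun _ => norm_one_sub_conU_le n ℓ r

theorem norm_kronecker_one_mul_le {A : Matrix (ARegister n m) (ARegister n m) ℂ}
    (hA : A ∈ Matrix.unitaryGroup (ARegister n m) ℂ)
    (X : Matrix (ARegister n m × (URegister n × Occ n ℓ)) (ARegister n m × (URegister n × Occ n ℓ)) ℂ) :
    ‖(A ⊗ₖ (1 : Matrix (URegister n × Occ n ℓ) (URegister n × Occ n ℓ) ℂ)) * X‖ ≤ ‖X‖ :=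
  (norm_mul_le _ _).trans (mul_le_of_le_one_left (norm_nonneg _)
    (norm_le_one_of_mem_unitaryGroup (kronecker_one_mem_unitaryGroup hA)))

theorem norm_one_le : ‖(1 : Matrix (URegister n × Occ n ℓ) (URegister n × Occ n ℓ) ℂ)‖ ≤ 1 :=
  norm_le_one_of_mem_unitaryGroup (one_mem _)

theorem norm_stepOp_le {A : Matrix (ARegister n m) (ARegister n m) ℂ}
    (hA : A ∈ Matrix.unitaryGroup (ARegister n m) ℂ)
    {B : Bool → Bits n → Matrix (Occ n ℓ) (Occ n ℓ) ℂ} (hB : ∀ y, ‖oracle B y‖ ≤ 1) :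
    ‖stepOp A B‖ ≤ 1 := by
  refine (norm_kronecker_one_mul_le hA _).trans (norm_controlled_le _ zero_le_one fun q => ?_)
  rw [query]
  split_ifs
  · exact hB _
  · exact norm_one_le

theorem norm_stepOp_leak_le {A : Matrix (ARegister n m) (ARegister n m) ℂ}
    (hA : A ∈ Matrix.unitaryGroup (ARegister n m) ℂ) {κ ε : ℝ} (hε : 0 ≤ ε) {r R : ℕ} (hrR : r ≤ R)
    (h : ∀ y, ‖(1 - conU n ℓ R) * oracle (kraus ℓ κ) y * conU n ℓ r‖ ≤ ε) :
    ‖(1 - conA n m ℓ R) * stepOp A (kraus ℓ κ) * conA n m ℓ r‖ ≤ ε := by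
  have h1 : (1 - conA n m ℓ R) * stepOp A (kraus ℓ κ) * conA n m ℓ r
      = (A ⊗ₖ 1) * controlled queryIndex ((fun _ => 1 - conU n ℓ R) * query (kraus ℓ κ)
        * fun _ => conU n ℓ r) := by
    rw [map_mul, map_mul, ← one_sub_conA, stepOp, ← mul_assoc (1 - conA n m ℓ R), sub_mul, one_mul,
      (conA_commute A R).eq, conA, conA]
    simp only [mul_assoc, mul_sub, sub_mul, one_mul]
  rw [h1]
  refine (norm_kronecker_one_mul_le hA _).trans (norm_controlled_le _ hε fun q => ?_)
  rw [Pi.mul_apply, Pi.mul_apply, query]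
  split_ifs
  · exact h _
  · rw [mul_one, sub_mul, one_mul, conU_mul_conU ℓ hrR, sub_self, norm_zero]
    exact hε

theorem conA_mulVec_startState (r : ℕ) (A : Matrix (ARegister n m) (ARegister n m) ℂ) :
    conA n m ℓ r *ᵥ startState ℓ A = startState ℓ A := by
  rw [conA, controlled_const, conU]
  funext ⟨a, w, u⟩
  have h := congrFun (Con_mulVec_initS n ℓ r) u
  rw [Matrix.mulVec, dotProduct] at h
  rw [Matrix.mulVec, dotProduct, Fintype.sum_prod_type, Finset.sum_eq_single a, Fintype.sum_prod_type,
    Finset.sum_eq_single w]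
  · simp only [startState]
    rw [← h, Finset.mul_sum, Finset.mul_sum]
    refine Finset.sum_congr rfl fun v _ => ?_
    rw [Matrix.kronecker_apply, Matrix.kronecker_apply, Matrix.one_apply_eq, Matrix.one_apply_eq]
    ring
  · intro w' _ hw
    refine Finset.sum_eq_zero fun v _ => ?_
    rw [Matrix.kronecker_apply, Matrix.kronecker_apply, Matrix.one_apply_ne hw.symm, zero_mul, mul_zero,
      zero_mul]
  · simp
  · intro a' _ ha
    refine Finset.sum_eq_zero fun v _ => ?_
    rw [Matrix.kronecker_apply, Matrix.one_apply_ne ha.symm, zero_mul, zero_mul]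
  · simp

theorem vecNorm_startState_le {A : Matrix (ARegister n m) (ARegister n m) ℂ}
    (hA : A ∈ Matrix.unitaryGroup (ARegister n m) ℂ) : vecNorm (startState ℓ A) ≤ 1 := by
  have hA1 : vecNorm (A *ᵥ initA n m) ≤ 1 := by
    refine vecNorm_mulVec_le_of_le (norm_le_one_of_mem_unitaryGroup hA) ?_
    simp [vecNorm, initA]
  have hU : ∑ w, ‖initU n w‖ ^ 2 = 1 := by
    rw [Finset.sum_eq_single (fun _ => false) (fun w _ hw => by simp [initU, hw]) (by simp)]
    simp [initU]
  have hsq : vecNorm (startState ℓ A) ^ 2 = vecNorm (A *ᵥ initA n m) ^ 2 *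
      ((∑ w, ‖initU n w‖ ^ 2) * vecNorm (initS n ℓ) ^ 2) := by
    simp only [vecNorm, EuclideanSpace.norm_sq_eq, startState, Fintype.sum_prod_type, norm_mul,
      mul_pow]
    simp only [← Finset.mul_sum, ← Finset.sum_mul]
  have hS : vecNorm (initS n ℓ) ≤ 1 := norm_initS_le n ℓ
  have h1 : vecNorm (startState ℓ A) ^ 2 ≤ 1 := by
    rw [hsq, hU, one_mul]
    exact mul_le_one₀ (pow_le_one₀ (vecNorm_nonneg _) hA1) (by positivity)
      (pow_le_one₀ (vecNorm_nonneg _) hS)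
  exact (sq_le_one_iff₀ (vecNorm_nonneg _)).1 h1

/-- The error of one sandwiched query is controlled by the leakage of the exact states before and
after it, and by the effect of the inner truncation. -/
theorem vecNorm_stepOp_sub_le {A : Matrix (ARegister n m) (ARegister n m) ℂ}
    (hA : A ∈ Matrix.unitaryGroup (ARegister n m) ℂ) {κ ε : ℝ} (hκ : 0 ≤ κ) (hε : 0 ≤ ε) {r R : ℕ}
    (h : ∀ y : Bits n, ‖(oracle (kraus ℓ κ) y - oracle (truncKraus ℓ κ R) y) * conU n ℓ r‖ ≤ ε)
    {v : ARegister n m × (URegister n × Occ n ℓ) → ℂ} (hv : vecNorm v ≤ 1) :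
    vecNorm ((stepOp A (kraus ℓ κ) - stepOp A (sandwich ℓ κ r R)) *ᵥ v)
      ≤ vecNorm ((1 - conA n m ℓ r) *ᵥ (stepOp A (kraus ℓ κ) *ᵥ v))
        + vecNorm ((1 - conA n m ℓ r) *ᵥ v) + ε := by
  let g1 : Bool × Bits n → Matrix (URegister n × Occ n ℓ) (URegister n × Occ n ℓ) ℂ :=
    fun q => if q.1 = true then 1 else 0
  let g2 : Bool × Bits n → Matrix (URegister n × Occ n ℓ) (URegister n × Occ n ℓ) ℂ :=
    fun q => if q.1 = true then conU n ℓ r * oracle (kraus ℓ κ) q.2 else 0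
  let g3 : Bool × Bits n → Matrix (URegister n × Occ n ℓ) (URegister n × Occ n ℓ) ℂ :=
    fun q => if q.1 = true then conU n ℓ r *
      ((oracle (kraus ℓ κ) q.2 - oracle (truncKraus ℓ κ R) q.2) * conU n ℓ r) else 0
  have hg : query (kraus ℓ κ) - query (sandwich ℓ κ r R)
      = g1 * ((fun _ => 1 - conU n ℓ r) * query (kraus ℓ κ))
        + g2 * (fun _ => 1 - conU n ℓ r) + g3 := by
    funext q
    simp only [Pi.sub_apply, Pi.add_apply, Pi.mul_apply, g1, g2, g3, query]
    split_ifs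
    · rw [oracle_sandwich]
      simp only [mul_sub, sub_mul, mul_one, one_mul, mul_assoc]
      abel
    · simp
  have hn1 : ‖controlled (queryIndex (m := m)) g1‖ ≤ 1 :=
    norm_controlled_le _ zero_le_one fun q => by
      simp only [g1]
      split_ifs
      · exact norm_one_le
      · rw [norm_zero]; exact zero_le_one
  have hn2 : ‖controlled (queryIndex (m := m)) g2‖ ≤ 1 :=
    norm_controlled_le _ zero_le_one fun q => by
      simp only [g2]
      split_ifs
      · rw [kraus_eq_truncKraus]
        exact (norm_mul_le _ _).trans (mul_le_one₀ (norm_conU_le n ℓ r) (norm_nonneg _)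
          (norm_oracle_truncKraus_le hκ _ _))
      · rw [norm_zero]; exact zero_le_one
  have hn3 : ‖controlled (queryIndex (m := m)) g3‖ ≤ ε :=
    norm_controlled_le _ hε fun q => by
      simp only [g3]
      split_ifs
      · calc _ ≤ 1 * ε := (norm_mul_le _ _).trans
              (mul_le_mul (norm_conU_le n ℓ r) (h _) (norm_nonneg _) zero_le_one)
          _ = ε := one_mul ε
      · rw [norm_zero]; exact hε
  have hU := kronecker_one_mem_unitaryGroup (ι := URegister n × Occ n ℓ) hA
  have hAn := norm_le_one_of_mem_unitaryGroup hU
  set W := A ⊗ₖ (1 : Matrix (URegister n × Occ n ℓ) (URegister n × Occ n ℓ) ℂ) with hW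
  have hWs : star W * W = 1 := Matrix.mem_unitaryGroup_iff'.1 hU
  have hcomm : (1 - conA n m ℓ r) * W = W * (1 - conA n m ℓ r) := by
    rw [sub_mul, mul_sub, one_mul, mul_one, (conA_commute A r).eq]
  have hWsn : ‖star W‖ ≤ 1 := by rwa [norm_star]
  -- undo the algorithm's unitary, to compare with the leakage after the step
  have hafter : (1 - conA n m ℓ r) * controlled queryIndex (query (kraus ℓ κ))
      = star W * ((1 - conA n m ℓ r) * stepOp A (kraus ℓ κ)) := by
    rw [stepOp, ← hW, ← mul_assoc (1 - conA n m ℓ r), hcomm, ← mul_assoc, ← mul_assoc, hWs, one_mul]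
  have hsplit : stepOp A (kraus ℓ κ) - stepOp A (sandwich ℓ κ r R)
      = W * (controlled queryIndex g1 * (star W * ((1 - conA n m ℓ r) * stepOp A (kraus ℓ κ)))
        + controlled queryIndex g2 * (1 - conA n m ℓ r) + controlled queryIndex g3) := by
    rw [← hafter, one_sub_conA, ← map_mul, ← map_mul, ← map_mul, ← map_add, ← map_add, ← hg, map_sub,
      mul_sub]
    rfl
  rw [hsplit, ← Matrix.mulVec_mulVec]
  refine (vecNorm_mulVec_le_self hAn _).trans ?_
  rw [Matrix.add_mulVec, Matrix.add_mulVec]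
  refine (vecNorm_add_le _ _).trans (add_le_add ((vecNorm_add_le _ _).trans (add_le_add ?_ ?_)) ?_)
  · rw [← Matrix.mulVec_mulVec, ← Matrix.mulVec_mulVec, ← Matrix.mulVec_mulVec]
    exact (vecNorm_mulVec_le_self hn1 _).trans (vecNorm_mulVec_le_self hWsn _)
  · rw [← Matrix.mulVec_mulVec]
    exact vecNorm_mulVec_le_self hn2 _
  · exact vecNorm_mulVec_le_of_le hn3 hv

/-- The radius of the condensate allowed after `t` queries. A query raises its square root by `ρ`. -/
def conRadius (ρ t : ℕ) : ℕ := ρ ^ 2 * (t + 1) ^ 2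

theorem conRadius_mono (ρ : ℕ) {s t : ℕ} (h : s ≤ t) : conRadius ρ s ≤ conRadius ρ t := by
  unfold conRadius
  gcongr

/-- The hybrid argument for all `T` queries: before each query the exact state has leaked at most
`T ε`, so each replacement costs at most `3 T ε`. -/
theorem norm_psiPQ_sub_psiSandwich_le {M κ : ℝ} {ρ : ℕ} (hM : 0 ≤ M) (hκ : 0 ≤ κ)
    (happ : ∀ (x : Bool) (Λ D : ℝ), 1 ≤ Λ → 0 ≤ D →
      PolyApprox Λ D (eFun κ x) (M * Real.exp (-(D / √Λ))))
    (hρ : 26 ≤ ρ) {T : ℕ} (hT : 1 ≤ T) {A : Matrix (ARegister n m) (ARegister n m) ℂ}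
    (hA : A ∈ Matrix.unitaryGroup (ARegister n m) ℂ) :
    ‖psiPQ ℓ κ T A - psiSandwich ℓ κ T (conRadius ρ T) (conRadius ρ (T + 1)) A‖
      ≤ 24 * M * (T : ℝ) ^ 2 * Real.exp (-(ρ / 26)) := by
  have hρ' : (26 : ℝ) ≤ ρ := by exact_mod_cast hρ
  set ε : ℝ := 8 * M * Real.exp (-(ρ / 26)) with hε
  have hε0 : 0 ≤ ε := by positivity
  have herr : ∀ (t : ℕ) (y : Bits n), ‖(oracle (kraus ℓ κ) y
      - oracle (truncKraus ℓ κ (conRadius ρ (t + 1))) y) * conU n ℓ (conRadius ρ t)‖ ≤ ε := by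
    intro t y
    refine norm_oracle_sub_mul_conU_le y hM happ (conRadius_mono ρ (Nat.le_succ t))
      (Nat.mul_pos (by positivity) (by positivity)) (by linarith) ?_
    have hsq : √((conRadius ρ (t + 1) : ℕ) : ℝ) = ρ * (t + 2) := by
      rw [show ((conRadius ρ (t + 1) : ℕ) : ℝ) = (ρ * (t + 2)) ^ 2 by
        unfold conRadius; push_cast; ring]
      exact Real.sqrt_sq (by positivity)
    have ht : (0 : ℝ) ≤ t := Nat.cast_nonneg t
    rw [hsq]
    unfold conRadius
    push_cast
    nlinarith [sq_nonneg (ρ : ℝ)]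
  have hstep : ‖stepOp A (kraus ℓ κ)‖ ≤ 1 := norm_stepOp_le (B := kraus ℓ κ) hA fun y => by
    rw [kraus_eq_truncKraus]; exact norm_oracle_truncKraus_le hκ ℓ y
  have hstep' : ‖stepOp A (sandwich ℓ κ (conRadius ρ T) (conRadius ρ (T + 1)))‖ ≤ 1 :=
    norm_stepOp_le (B := sandwich ℓ κ _ _) hA fun y => by
      rw [oracle_sandwich]
      refine (norm_mul_le _ _).trans (mul_le_one₀ ?_ (norm_nonneg _) (norm_conU_le _ _ _))
      exact (norm_mul_le _ _).trans (mul_le_one₀ (norm_conU_le _ _ _) (norm_nonneg _)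
        (norm_oracle_truncKraus_le hκ _ _))
  have hv := vecNorm_startState_le (ℓ := ℓ) hA
  have hleak := vecNorm_leak_le (P := fun t => conA n m ℓ (conRadius ρ t)) hstep hv
    (fun t => norm_one_sub_conA_le _) (conA_mulVec_startState _ A)
    (fun t => norm_stepOp_leak_le hA hε0 (conRadius_mono ρ (Nat.le_succ t))
      fun y => norm_oracle_leak_le (conRadius_mono ρ (Nat.le_succ t)) y (herr t y))
  have hleakT : ∀ t ≤ T, vecNorm ((1 - conA n m ℓ (conRadius ρ T)) *ᵥ
      ((stepOp A (kraus ℓ κ) ^ t) *ᵥ startState ℓ A)) ≤ T * ε := fun t ht => by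
    have hmul : (1 - conA n m ℓ (conRadius ρ T)) * (1 - conA n m ℓ (conRadius ρ t))
        = 1 - conA n m ℓ (conRadius ρ T) := by
      rw [one_sub_conA, one_sub_conA, ← map_mul]
      congr 1
      funext q
      rw [Pi.mul_apply, mul_sub, mul_one, sub_mul, one_mul, conU_mul_conU ℓ (conRadius_mono ρ ht),
        sub_self, sub_zero]
    rw [← hmul, ← Matrix.mulVec_mulVec]
    refine (vecNorm_mulVec_le_self (norm_one_sub_conA_le _) _).trans ((hleak t).trans ?_)
    gcongr
  have hdiff := vecNorm_pow_sub_pow_le (v := startState ℓ A) (δ := 3 * T * ε)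
    (S := stepOp A (kraus ℓ κ)) hstep' T fun t ht => by
      refine (vecNorm_stepOp_sub_le hA hκ hε0 (herr T) (vecNorm_pow_mulVec_le hstep hv t)).trans ?_
      have h1 := hleakT (t + 1) ht
      rw [pow_succ', ← Matrix.mulVec_mulVec] at h1
      have h2 := hleakT t ht.le
      have hT1 : (1 : ℝ) ≤ T := by exact_mod_cast hT
      nlinarith
  rw [psiPQ, psiSandwich, algState_eq, algState_eq, ← WithLp.toLp_sub]
  refine hdiff.trans (le_of_eq ?_)
  rw [hε]; ring

end

end BosonOracle

end

theorem mainTheorem9 :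
    ∃ C : ℝ, 0 < C ∧ ∀ (n T : ℕ) (ι : ℝ), 1 ≤ n → 1 ≤ T → 0 < ι →
      ∃ r R : ℕ, 0 < r ∧ 0 < R ∧
        (r : ℝ) ≤ C * ((n : ℝ) ^ 2 * (T : ℝ) ^ 5 *
          (max 1 (Real.log T)) ^ 3 * (max 1 (Real.log (1 / ι))) ^ 2) ∧
        (R : ℝ) ≤ C * ((n : ℝ) ^ 3 * (T : ℝ) ^ 6 *
          (max 1 (Real.log T)) ^ 4 * (max 1 (Real.log (1 / ι))) ^ 3) ∧
        ∀ (ℓ m : ℕ) (κ : ℝ), 1 ≤ ℓ → 0 ≤ κ → κ ≤ 1 →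
          ∀ A ∈ Matrix.unitaryGroup (BosonOracle.ARegister n m) ℂ,
            ‖BosonOracle.psiPQ ℓ κ T A - BosonOracle.psiSandwich ℓ κ T r R A‖ ≤ ι := by
  obtain ⟨M, hM, happ⟩ := BosonOracle.exists_polyApprox_eFun
  set c : ℝ := max 1 (Real.log (24 * M)) with hc
  have hc1 : 1 ≤ c := le_max_left _ _
  refine ⟨9 * (105 * c) ^ 2, by positivity, fun n T ι hn hT hι => ?_⟩
  set a : ℝ := max 1 (Real.log T) with ha
  set b : ℝ := max 1 (Real.log (1 / ι)) with hb
  have ha1 : 1 ≤ a := le_max_left _ _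
  have hb1 : 1 ≤ b := le_max_left _ _
  have hn1 : (1 : ℝ) ≤ n := by exact_mod_cast hn
  have hT1 : (1 : ℝ) ≤ T := by exact_mod_cast hT
  have hab : 1 ≤ a * b := one_le_mul_of_one_le_of_one_le ha1 hb1
  have hcab : 1 ≤ c * (a * b) := one_le_mul_of_one_le_of_one_le hc1 hab
  -- four logarithms have to be beaten at rate `1 / 26`: one of `24 M`, two of `T`, one of `1 / ι`
  set ρ : ℕ := ⌈104 * (c * (a * b))⌉₊ with hρ
  have hρl : 104 * (c * (a * b)) ≤ ρ := Nat.le_ceil _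
  have hρu : (ρ : ℝ) ≤ 105 * (c * (a * b)) := by
    have := (Nat.ceil_lt_add_one (by positivity : 0 ≤ 104 * (c * (a * b)))).le
    linarith
  have hρ26 : 26 ≤ ρ := by
    have : (26 : ℝ) ≤ ρ := by linarith
    exact_mod_cast this
  have hsize : ∀ t : ℕ, t ≤ T + 1 → ((BosonOracle.conRadius ρ t : ℕ) : ℝ)
      ≤ 9 * (105 * c) ^ 2 * (a ^ 2 * b ^ 2 * (T : ℝ) ^ 2) := fun t ht => by
    have ht' : (t : ℝ) + 1 ≤ 3 * T := by
      have : (t : ℝ) ≤ T + 1 := by exact_mod_cast ht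
      linarith
    unfold BosonOracle.conRadius
    push_cast
    calc (ρ : ℝ) ^ 2 * ((t : ℝ) + 1) ^ 2 ≤ (105 * (c * (a * b))) ^ 2 * (3 * T) ^ 2 := by gcongr
      _ = _ := by ring
  refine ⟨BosonOracle.conRadius ρ T, BosonOracle.conRadius ρ (T + 1), ?_, ?_, ?_, ?_, fun ℓ m κ _ hκ hκ1 A hA => ?_⟩
  · unfold BosonOracle.conRadius; positivity
  · unfold BosonOracle.conRadius; positivity
  · refine (hsize T (Nat.le_succ T)).trans (mul_le_mul_of_nonneg_left ?_ (by positivity))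
    calc a ^ 2 * b ^ 2 * (T : ℝ) ^ 2 = 1 * (T : ℝ) ^ 2 * a ^ 2 * b ^ 2 := by ring
      _ ≤ _ := by
        gcongr ?_ * ?_ * ?_ * _
        · exact one_le_pow₀ hn1
        · exact pow_le_pow_right₀ hT1 (by norm_num)
        · exact pow_le_pow_right₀ ha1 (by norm_num)
  · refine (hsize (T + 1) le_rfl).trans (mul_le_mul_of_nonneg_left ?_ (by positivity))
    calc a ^ 2 * b ^ 2 * (T : ℝ) ^ 2 = 1 * (T : ℝ) ^ 2 * a ^ 2 * b ^ 2 := by ring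
      _ ≤ _ := by
        gcongr ?_ * ?_ * ?_ * ?_
        · exact one_le_pow₀ hn1
        · exact pow_le_pow_right₀ hT1 (by norm_num)
        · exact pow_le_pow_right₀ ha1 (by norm_num)
        · exact pow_le_pow_right₀ hb1 (by norm_num)
  · refine (BosonOracle.norm_psiPQ_sub_psiSandwich_le hM.le hκ (fun x Λ D => happ κ x Λ D hκ hκ1) hρ26 hT
      hA).trans ?_
    have hT0 : (0 : ℝ) < T := by linarith
    have h1 : Real.log (24 * M) ≤ c * (a * b) := by
      have : Real.log (24 * M) ≤ c := le_max_right _ _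
      nlinarith
    have h2 : Real.log T ≤ c * (a * b) := by
      have : Real.log T ≤ a := le_max_right _ _
      have : a ≤ a * b := le_mul_of_one_le_right (by linarith) hb1
      nlinarith
    have h3 : -Real.log ι ≤ c * (a * b) := by
      have : Real.log (1 / ι) ≤ b := le_max_right _ _
      rw [one_div, Real.log_inv] at this
      have : b ≤ a * b := le_mul_of_one_le_left (by linarith) ha1
      nlinarith
    rw [← Real.log_le_log_iff (by positivity) hι, Real.log_mul (by positivity) (by positivity),
      Real.log_mul (by positivity) (by positivity), Real.log_pow, Real.log_exp]
    push_cast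
    linarith
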